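/- **Definitions.** A random matrix $M\in\mathbb R^{k\times d}$ is $(\varepsilon,\delta)$-Johnson–Lindenstrauss (JL) if for every unit vector $x\in\mathbb R^d$ we have $\Pr\big[\,|\|Mx\|_2-1|\le\varepsilon\,\big]\ge 1-\delta$. For a perfect square $m\ge 1$ and a real $\tau\ge 1$, the $(m,\tau)$-TCU model is a random access machine, with unit-cost operations on addresses and on real numbers, that has one additional instruction: it multiplies two $\sqrt m\times\sqrt m$ matrices stored in memory (row by row, with any spacing between rows) in time $\tau$. The memory initially holds the input vector $x$ together with finite precomputed data that may depend on $M$, $m$ and $\tau$ but not on $x$. **Theorem.** There are a universal constant $C>0$ and a single TCU program such that the following holds for all integers $d\ge 1$, $k\ge 0$ and all reals $\varepsilon,\delta>0$ with $k\ge C\varepsilon^{-2}\log(1/\delta)$ (in particular for $k=\lceil C\varepsilon^{-2}\log(1/\delta)\rceil$ when $\delta\le1$). There is an $(\varepsilon,\delta)$-JL random matrix $M\in\mathbb R^{k\times d}$ such that, for every outcome of $M$ and for all $m$ and $\tau$ with $\sqrt m\le k$, the program computes $Mx$ for every $x\in\mathbb R^d$ on the $(m,\tau)$-TCU model in time $$O\Big(\big(dk+k^2\sqrt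 m\,\log_+^3\tfrac dk\big)\,\tau\, m^{-3/2}\Big),\qquad \log_+ y:=\max\{1,\log y\},$$ where the constant in the $O$ is universal. (For $d\ge 2k$ the factor $\log_+^3\frac dk$ can be replaced by $\log^3\frac dk$, at the cost of a universal constant.) In particular, if $\tau\le Bm$, the time is at most a universal constant times $$B\Big(\frac{dk}{\sqrt m}+k^2\log_+^3\frac dk\Big).$$ -/

import Mathlib

open scoped Matrix

namespace TCU

/-- Instructions of the machine: a random access machine with an index memory `reg` holding natural
numbers (used for addresses and control), a data memory `mem` holding real numbers, both with
indirect addressing, and one tensor instruction. All arguments are numbers of index cells, except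
for the immediate constants `n`, `z` and the jump targets `l`. A data operand `a` means the data
cell whose address is stored in index cell `a`. -/
inductive Instr : Type
  | iconst (r n : ℕ)
  | iadd (r a b : ℕ)
  | isub (r a b : ℕ)
  | imul (r a b : ℕ)
  | iload (r a : ℕ)
  | istore (a r : ℕ)
  | jumpZero (r l : ℕ)
  | rconst (a : ℕ) (z : ℤ)
  | rcopy (c a : ℕ)
  | radd (c a b : ℕ)
  | rsub (c a b : ℕ)
  | rmul (c a b : ℕ)
  | jumpPos (a l : ℕ)
  | tensor (a lda b ldb c ldc : ℕ)

/-- A machine configuration: program counter, index memory, data memory. -/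
structure State : Type where
  pc : ℕ
  reg : ℕ → ℕ
  mem : ℕ → ℝ

/-- The entry in row `i` and column `j` of a matrix stored row by row from address `a` on, where
consecutive rows start `ld` cells apart. -/
def entry (mem : ℕ → ℝ) (a ld i j : ℕ) : ℝ := mem (a + i * ld + j)

/-- The data memory after the `s × s` matrices at `a` and `b` have been read and their product
has been written to the `s × s` matrix at `c`. If `s ≤ ldc`, address `p` holds the entry of
the latter in row `(p - c) / ldc` and column `(p - c) % ldc`, if these are both less than `s`. -/
noncomputable def multiply (s : ℕ) (mem : ℕ → ℝ) (a lda b ldb c ldc : ℕ) : ℕ → ℝ := fun p =>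
  if c ≤ p ∧ (p - c) / ldc < s ∧ (p - c) % ldc < s then
    ∑ l ∈ Finset.range s, entry mem a lda ((p - c) / ldc) l * entry mem b ldb l ((p - c) % ldc)
  else mem p

/-- The effect of one instruction on a machine whose tensor unit multiplies `s × s` matrices.
A tensor instruction whose output rows would overlap (`ldc < s`) is illegal: no successor. -/
noncomputable def Instr.exec (s : ℕ) (σ : State) : Instr → Option State
  | iconst r n => some ⟨σ.pc + 1, Function.update σ.reg r n, σ.mem⟩
  | iadd r a b => some ⟨σ.pc + 1, Function.update σ.reg r (σ.reg a + σ.reg b), σ.mem⟩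
  | isub r a b => some ⟨σ.pc + 1, Function.update σ.reg r (σ.reg a - σ.reg b), σ.mem⟩
  | imul r a b => some ⟨σ.pc + 1, Function.update σ.reg r (σ.reg a * σ.reg b), σ.mem⟩
  | iload r a => some ⟨σ.pc + 1, Function.update σ.reg r (σ.reg (σ.reg a)), σ.mem⟩
  | istore a r => some ⟨σ.pc + 1, Function.update σ.reg (σ.reg a) (σ.reg r), σ.mem⟩
  | jumpZero r l => some ⟨if σ.reg r = 0 then l else σ.pc + 1, σ.reg, σ.mem⟩
  | rconst a z => some ⟨σ.pc + 1, σ.reg, Function.update σ.mem (σ.reg a) (z : ℝ)⟩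
  | rcopy c a => some ⟨σ.pc + 1, σ.reg, Function.update σ.mem (σ.reg c) (σ.mem (σ.reg a))⟩
  | radd c a b => some ⟨σ.pc + 1, σ.reg,
      Function.update σ.mem (σ.reg c) (σ.mem (σ.reg a) + σ.mem (σ.reg b))⟩
  | rsub c a b => some ⟨σ.pc + 1, σ.reg,
      Function.update σ.mem (σ.reg c) (σ.mem (σ.reg a) - σ.mem (σ.reg b))⟩
  | rmul c a b => some ⟨σ.pc + 1, σ.reg,
      Function.update σ.mem (σ.reg c) (σ.mem (σ.reg a) * σ.mem (σ.reg b))⟩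
  | jumpPos a l => some ⟨open Classical in if 0 < σ.mem (σ.reg a) then l else σ.pc + 1,
      σ.reg, σ.mem⟩
  | tensor a lda b ldb c ldc =>
      if s ≤ σ.reg ldc then
        some ⟨σ.pc + 1, σ.reg, multiply s σ.mem (σ.reg a) (σ.reg lda) (σ.reg b) (σ.reg ldb)
          (σ.reg c) (σ.reg ldc)⟩
      else none

/-- A tensor instruction takes time `τ`, every other instruction takes unit time. -/
def Instr.cost (τ : ℝ) : Instr → ℝ
  | tensor .. => τ
  | _ => 1

/-- `Runs s τ P σ t σ'`: started in `σ`, the program `P` halts (by leaving the range of the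
program) in `σ'`, after time exactly `t`, on the machine whose tensor unit multiplies `s × s`
matrices in time `τ`. -/
inductive Runs (s : ℕ) (τ : ℝ) (P : List Instr) : State → ℝ → State → Prop
  | halt (σ : State) (h : P[σ.pc]? = none) : Runs s τ P σ 0 σ
  | step (σ σ₁ σ' : State) (ins : Instr) (t : ℝ) (hi : P[σ.pc]? = some ins)
      (he : ins.exec s σ = some σ₁) (hr : Runs s τ P σ₁ t σ') :
      Runs s τ P σ (ins.cost τ + t) σ'

/-- The initial configuration for an input vector `x` and precomputed data `u`, `w`: the index
memory holds `u`, the data memory holds the entries of `x` followed by `w`, and all other cells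
are zero. -/
noncomputable def initial {d : ℕ} (u : List ℕ) (w : List ℝ) (x : Fin d → ℝ) : State where
  pc := 0
  reg := fun i => u.getD i 0
  mem := fun i => if h : i < d then x ⟨i, h⟩ else w.getD (i - d) 0

/-- In configuration `σ` the vector `y` is stored in consecutive data cells, starting at the
address in index cell `0`. -/
def Output {k : ℕ} (σ : State) (y : Fin k → ℝ) : Prop :=
  ∀ i : Fin k, σ.mem (σ.reg 0 + i) = y i

end TCU

/-- The random matrix `M` is `(ε, δ)`-Johnson-Lindenstrauss: every fixed unit vector `x` satisfies
`|‖M x‖₂ - 1| ≤ ε` with probability at least `1 - δ`. -/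
structure IsJohnsonLindenstrauss {Ω : Type} [MeasurableSpace Ω] (μ : MeasureTheory.Measure Ω)
    {k d : ℕ} (M : Ω → Matrix (Fin k) (Fin d) ℝ) (ε δ : ℝ) : Prop where
  measurable : ∀ i j, Measurable fun ω => M ω i j
  norm_close : ∀ x : EuclideanSpace ℝ (Fin d), ‖x‖ = 1 →
    1 - δ ≤ μ.real {ω | |‖WithLp.toLp 2 (M ω *ᵥ x.ofLp)‖ - 1| ≤ ε}

/-! The random matrix is a composition of independent sign matrices, scaled to preserve squared
norms in expectation and shaped so that each factor suits the tensor unit. The vector is viewed as a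
matrix with `2 ^ S` columns and multiplied by a sign matrix with `k` rows. Then, `S` times, the
right half of the columns is placed below the left half, which keeps the Frobenius norm, and the
result is multiplied by a sign matrix with `r = k * (S + 1)` rows. The single remaining column is
sent to `k` coordinates by a last sign matrix (`chain`, `sketch`).

With `2 ^ S` of order `(d / k) / log_+² (d / k)` (`exists_width`) and `s = √m`, the first product
takes about `d k / s³` tensor products. The halvings form a geometric series dominated by `r² 2 ^ S
/ s³`. Rounding up to whole blocks costs `r² / s²` on each of `S` levels, and `r² S` of order `k²
S³` is the origin of the cubed logarithm (`chainCost_le`, `exists_sketchCost_le`).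

For the norm, a sign matrix with `ρ` rows maps a matrix of squared norm `N` to one whose squared
norm has moment generating function at most `exp (t N + 300 (t N)² / ρ)`
(`expect_exp_frobSq_signMul`). A two-sided Chernoff bound is carried backwards through the factors
(`expect_le_tailBound`). The quantities `1 / ρ` merely add up, and their total is at most `3 / k`,
so the tail is that of a dense sign matrix up to constants (`exists_random_sketch`).

When `δ` is near `1`, `ε² k` may be tiny and this tail says nothing, while success probability `1 -
δ` is still required. The squared norm lies in a window of width `O(1 / √k)` around `1` with
constant probability (`exists_window`), and a random rescaling over a grid of mesh `ε` covering the
window succeeds often enough.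

On the machine side, a fixed interpreter executes a precomputed straight-line list of tensor
products and additions at `O(τ)` per entry. Copying, clearing, accumulating and transposing are all
done by tensor products, because handling entries one by one would be too slow when `τ` is small. -/

namespace TCU

/-! ### Straight-line lists of memory operations and their interpreter -/

/-- A memory operation: a product by the tensor unit or an addition of two cells. The arguments are
addresses and row spacings. -/
inductive Op : Type
  | mul (a lda b ldb c ldc : ℕ)
  | add (a b c : ℕ)

/-- The effect of a memory operation on the data memory. -/
noncomputable def Op.apply (s : ℕ) : Op → (ℕ → ℝ) → ℕ → ℝ
  | mul a lda b ldb c ldc, mem => multiply s mem a lda b ldb c ldc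
  | add a b c, mem => Function.update mem c (mem a + mem b)

/-- A memory operation is legal if the rows it writes do not overlap. -/
def Op.Valid (s : ℕ) : Op → Prop
  | mul _ _ _ _ _ ldc => s ≤ ldc
  | add _ _ _ => True

/-- The encoding of a memory operation in index memory. -/
def Op.code : Op → List ℕ
  | mul a lda b ldb c ldc => [1, a, lda, b, ldb, c, ldc]
  | add a b c => [2, a, 0, b, 0, c, 0]

/-- The effect of a list of memory operations, executed from left to right. -/
noncomputable def runOps (s : ℕ) (ops : List Op) (mem : ℕ → ℝ) : ℕ → ℝ :=
  ops.foldl (fun mem o => o.apply s mem) mem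

/-- The program that executes the list of memory operations whose encodings are stored in index
memory from cell `16` on. -/
def interpreter : List Instr :=
  [.iload 2 1, .jumpZero 2 100,
   .iadd 1 1 3, .iload 4 1, .iadd 1 1 3, .iload 5 1, .iadd 1 1 3, .iload 6 1,
   .iadd 1 1 3, .iload 7 1, .iadd 1 1 3, .iload 8 1, .iadd 1 1 3, .iload 9 1, .iadd 1 1 3,
   .isub 2 2 3, .jumpZero 2 19,
   .radd 8 4 6, .jumpZero 10 0,
   .tensor 4 5 6 7 8 9, .jumpZero 10 0]

theorem Runs.iload {s : ℕ} {τ : ℝ} {P : List Instr} {pc r a v w : ℕ} {reg : ℕ → ℕ}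
    {mem : ℕ → ℝ} {T : ℝ} {σ' : State} (hi : P[pc]? = some (.iload r a)) (ha : reg a = v)
    (hv : reg v = w) (hr : Runs s τ P ⟨pc + 1, Function.update reg r w, mem⟩ T σ') :
    Runs s τ P ⟨pc, reg, mem⟩ (1 + T) σ' := by
  subst ha hv
  exact Runs.step ⟨pc, reg, mem⟩ _ _ _ _ hi rfl hr

theorem Runs.iadd {s : ℕ} {τ : ℝ} {P : List Instr} {pc r a b v : ℕ} {reg : ℕ → ℕ}
    {mem : ℕ → ℝ} {T : ℝ} {σ' : State} (hi : P[pc]? = some (.iadd r a b)) (hv : reg a + reg b = v)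
    (hr : Runs s τ P ⟨pc + 1, Function.update reg r v, mem⟩ T σ') :
    Runs s τ P ⟨pc, reg, mem⟩ (1 + T) σ' := by
  subst hv
  exact Runs.step ⟨pc, reg, mem⟩ _ _ _ _ hi rfl hr

theorem Runs.isub {s : ℕ} {τ : ℝ} {P : List Instr} {pc r a b v : ℕ} {reg : ℕ → ℕ}
    {mem : ℕ → ℝ} {T : ℝ} {σ' : State} (hi : P[pc]? = some (.isub r a b)) (hv : reg a - reg b = v)
    (hr : Runs s τ P ⟨pc + 1, Function.update reg r v, mem⟩ T σ') :
    Runs s τ P ⟨pc, reg, mem⟩ (1 + T) σ' := by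
  subst hv
  exact Runs.step ⟨pc, reg, mem⟩ _ _ _ _ hi rfl hr

theorem Runs.jumpZero_pos {s : ℕ} {τ : ℝ} {P : List Instr} {pc r l : ℕ} {reg : ℕ → ℕ}
    {mem : ℕ → ℝ} {T : ℝ} {σ' : State} (hi : P[pc]? = some (.jumpZero r l)) (hv : reg r = 0)
    (hr : Runs s τ P ⟨l, reg, mem⟩ T σ') :
    Runs s τ P ⟨pc, reg, mem⟩ (1 + T) σ' := by
  refine Runs.step ⟨pc, reg, mem⟩ _ _ _ _ hi ?_ hr
  simp [Instr.exec, hv]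

theorem Runs.jumpZero_neg {s : ℕ} {τ : ℝ} {P : List Instr} {pc r l : ℕ} {reg : ℕ → ℕ}
    {mem : ℕ → ℝ} {T : ℝ} {σ' : State} (hi : P[pc]? = some (.jumpZero r l)) (hv : reg r ≠ 0)
    (hr : Runs s τ P ⟨pc + 1, reg, mem⟩ T σ') :
    Runs s τ P ⟨pc, reg, mem⟩ (1 + T) σ' := by
  refine Runs.step ⟨pc, reg, mem⟩ _ _ _ _ hi ?_ hr
  simp [Instr.exec, hv]

/-- The parameters of the operation at cell `ptr` of index memory are loaded. -/
theorem runs_interpreter_load {s : ℕ} {τ : ℝ} {reg : ℕ → ℕ} {mem : ℕ → ℝ}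
    {ptr o a lda b ldb c ldc : ℕ} (hptr : 16 ≤ ptr) (h1 : reg 1 = ptr) (h3 : reg 3 = 1)
    (ho : reg ptr = o) (ho' : o ≠ 0) (ha : reg (ptr + 1) = a) (hlda : reg (ptr + 2) = lda)
    (hb : reg (ptr + 3) = b) (hldb : reg (ptr + 4) = ldb) (hc : reg (ptr + 5) = c)
    (hldc : reg (ptr + 6) = ldc) :
    ∃ reg' : ℕ → ℕ, (∀ i, (i = 0 ∨ i = 3 ∨ 10 ≤ i) → reg' i = reg i) ∧ reg' 1 = ptr + 7 ∧
      reg' 2 = o - 1 ∧ reg' 4 = a ∧ reg' 5 = lda ∧ reg' 6 = b ∧ reg' 7 = ldb ∧ reg' 8 = c ∧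
      reg' 9 = ldc ∧
      ∀ T σ', Runs s τ interpreter ⟨16, reg', mem⟩ T σ' →
        Runs s τ interpreter ⟨0, reg, mem⟩ (16 + T) σ' := by
  have key : ∀ (x y : ℕ), x < 16 → (ptr + y ≠ x) := fun x y h => by omega
  have key0 : ∀ (x : ℕ), x < 16 → (ptr ≠ x) := fun x h => by omega
  have hi : ∀ i, (i = 0 ∨ i = 3 ∨ 10 ≤ i) → i ≠ 1 ∧ i ≠ 2 ∧ i ≠ 4 ∧ i ≠ 5 ∧ i ≠ 6 ∧ i ≠ 7 ∧ i ≠ 8 ∧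
    i ≠ 9 := by omega
  refine ⟨(Function.update (Function.update (Function.update (Function.update (Function.update
    (Function.update (Function.update (Function.update (Function.update (Function.update
    (Function.update (Function.update (Function.update (Function.update (Function.update reg 2
    o) 1 (ptr + 1)) 4 a) 1 (ptr + 2)) 5 lda) 1 (ptr + 3)) 6 b) 1 (ptr + 4)) 7 ldb) 1 (ptr +
    5)) 8 c) 1 (ptr + 6)) 9 ldc) 1 (ptr + 7)) 2 (o - 1)),
    ?_, ?_, ?_, ?_, ?_, ?_, ?_, ?_, ?_, ?_⟩
  rotate_left 9
  · intro T σ' hr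
    have : 16 + T = 1 + (1 + (1 + (1 + (1 + (1 + (1 + (1 + (1 + (1 + (1 + (1 + (1 + (1 + (1 +
      (1 + T))))))))))))))) := by ring
    rw [this]
    refine Runs.iload rfl h1 ho ?_
    refine Runs.jumpZero_neg rfl (by simpa using ho') ?_
    refine Runs.iadd (v := ptr + 1) rfl (by simp [h1, h3]) ?_
    refine Runs.iload (v := ptr + 1) (w := a) rfl (by rfl) (by simp [key, key0, ha]) ?_
    refine Runs.iadd (v := ptr + 2) rfl (by simp [h3]) ?_
    refine Runs.iload (v := ptr + 2) (w := lda) rfl (by simp) (by simp [key, key0, hlda]) ?_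
    refine Runs.iadd (v := ptr + 3) rfl (by simp [h3]) ?_
    refine Runs.iload (v := ptr + 3) (w := b) rfl (by simp) (by simp [key, hb]) ?_
    refine Runs.iadd (v := ptr + 4) rfl (by simp [h3]) ?_
    refine Runs.iload (v := ptr + 4) (w := ldb) rfl (by simp) (by simp [key, key0, hldb]) ?_
    refine Runs.iadd (v := ptr + 5) rfl (by simp [h3]) ?_
    refine Runs.iload (v := ptr + 5) (w := c) rfl (by simp) (by simp [key, key0, hc]) ?_
    refine Runs.iadd (v := ptr + 6) rfl (by simp [h3]) ?_
    refine Runs.iload (v := ptr + 6) (w := ldc) rfl (by simp) (by simp [key, key0, hldc]) ?_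
    refine Runs.iadd (v := ptr + 7) rfl (by simp [h3]) ?_
    refine Runs.isub (v := o - 1) rfl (by simp [h3]) ?_
    exact hr
  · intro i h
    obtain ⟨e1, e2, e4, e5, e6, e7, e8, e9⟩ := hi i h
    simp [e1, e2, e4, e5, e6, e7, e8, e9]
  all_goals simp

/-- One round of the interpreter. -/
theorem runs_interpreter_op {s : ℕ} {τ : ℝ} {reg : ℕ → ℕ} {mem : ℕ → ℝ} {ptr : ℕ} (o : Op)
    (hτ : 1 ≤ τ) (hptr : 16 ≤ ptr) (h1 : reg 1 = ptr) (h3 : reg 3 = 1) (h10 : reg 10 = 0)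
    (hv : o.Valid s) (ho : ∀ i : ℕ, i < 7 → reg (ptr + i) = o.code.getD i 0) :
    ∃ (reg' : ℕ → ℕ) (T : ℝ), (∀ i, (i = 0 ∨ i = 3 ∨ 10 ≤ i) → reg' i = reg i) ∧
      reg' 1 = ptr + 7 ∧ T ≤ 19 * τ ∧
      ∀ T' σ', Runs s τ interpreter ⟨0, reg', o.apply s mem⟩ T' σ' →
        Runs s τ interpreter ⟨0, reg, mem⟩ (T + T') σ' := by
  cases o with
  | mul a lda b ldb c ldc =>
    obtain ⟨reg', hk, e1, e2, e4, e5, e6, e7, e8, e9, hr⟩ := runs_interpreter_load (s := s) (τ := τ)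
      (mem := mem) hptr h1 h3 (ho 0 (by norm_num)) (by simp [Op.code]) (ho 1 (by norm_num))
      (ho 2 (by norm_num)) (ho 3 (by norm_num)) (ho 4 (by norm_num)) (ho 5 (by norm_num))
      (ho 6 (by norm_num))
    simp only [Op.code, List.getD_cons_succ, List.getD_cons_zero] at e2 e4 e5 e6 e7 e8 e9
    refine ⟨reg', 16 + (1 + (τ + 1)), hk, e1, by linarith, fun T' σ' h => ?_⟩
    have : 16 + (1 + (τ + 1)) + T' = 16 + (1 + (τ + (1 + T'))) := by ring
    rw [this]
    apply hr
    refine Runs.jumpZero_pos rfl (by simpa using e2) ?_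
    refine Runs.step (ins := .tensor 4 5 6 7 8 9) _ ⟨20, reg', (Op.mul a lda b ldb c ldc).apply s mem⟩
      _ _ rfl ?_ ?_
    · simp only [Op.Valid] at hv
      simp [Instr.exec, e4, e5, e6, e7, e8, e9, Op.apply, hv]
    · exact Runs.jumpZero_pos rfl (by rw [hk 10 (by simp), h10]) h
  | add a b c =>
    obtain ⟨reg', hk, e1, e2, e4, e5, e6, e7, e8, e9, hr⟩ := runs_interpreter_load (s := s) (τ := τ)
      (mem := mem) hptr h1 h3 (ho 0 (by norm_num)) (by simp [Op.code]) (ho 1 (by norm_num))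
      (ho 2 (by norm_num)) (ho 3 (by norm_num)) (ho 4 (by norm_num)) (ho 5 (by norm_num))
      (ho 6 (by norm_num))
    simp only [Op.code, List.getD_cons_succ, List.getD_cons_zero] at e2 e4 e5 e6 e7 e8 e9
    refine ⟨reg', 16 + (1 + (1 + 1)), hk, e1, by linarith, fun T' σ' h => ?_⟩
    have : (16 : ℝ) + (1 + (1 + 1)) + T' = 16 + (1 + (1 + (1 + T'))) := by ring
    rw [this]
    apply hr
    refine Runs.jumpZero_neg rfl (by simp [e2]) ?_
    refine Runs.step (ins := .radd 8 4 6) _ ⟨18, reg', (Op.add a b c).apply s mem⟩ _ _ rfl ?_ ?_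
    · simp [Instr.exec, e4, e6, e8, Op.apply]
    · exact Runs.jumpZero_pos rfl (by rw [hk 10 (by simp), h10]) h

theorem Op.code_length (o : Op) : o.code.length = 7 := by cases o <;> rfl

/-- The interpreter executes the list of operations encoded in index memory. -/
theorem runs_interpreter {s : ℕ} {τ : ℝ} (hτ : 1 ≤ τ) (ops : List Op) :
    ∀ {reg : ℕ → ℕ} {mem : ℕ → ℝ} {ptr : ℕ}, 16 ≤ ptr → reg 1 = ptr → reg 3 = 1 → reg 10 = 0 →
      (∀ o ∈ ops, o.Valid s) →
      (∀ i : ℕ, reg (ptr + i) = (ops.flatMap Op.code).getD i 0) →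
      ∃ (t : ℝ) (σ : State), Runs s τ interpreter ⟨0, reg, mem⟩ t σ ∧
        σ.mem = runOps s ops mem ∧ σ.reg 0 = reg 0 ∧ t ≤ 19 * τ * (ops.length + 1) := by
  induction ops with
  | nil =>
    intro reg mem ptr hptr h1 h3 h10 _ ho
    refine ⟨1 + (1 + 0), ⟨100, Function.update reg 2 0, mem⟩, ?_, rfl, by simp, ?_⟩
    -- Past the last encoded operation the list yields its default value `0`; read as an opcode, it
    -- sends control to `100`, outside the program.
    · refine Runs.iload rfl h1 (w := 0) (by simpa using ho 0) ?_
      refine Runs.jumpZero_pos rfl (by simp) ?_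
      exact Runs.halt _ rfl
    · simp; linarith
  | cons o ops ih =>
    intro reg mem ptr hptr h1 h3 h10 hv ho
    obtain ⟨reg', T, hk, e1, hT, hr⟩ := runs_interpreter_op (s := s) (τ := τ) (mem := mem) o hτ hptr
      h1 h3 h10 (hv o (by simp)) (fun i hi => by
        rw [ho i, List.flatMap_cons, List.getD_append _ _ _ _ (by rw [o.code_length]; exact hi)])
    obtain ⟨t, σ, h, hm, h0, ht⟩ := ih (reg := reg') (mem := o.apply s mem) (ptr := ptr + 7)
      (by omega) e1 (by rw [hk 3 (by simp), h3]) (by rw [hk 10 (by simp), h10])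
      (fun o' ho' => hv o' (by simp [ho'])) (fun i => by
        rw [hk _ (by omega), Nat.add_assoc, ho, List.flatMap_cons,
          List.getD_append_right _ _ _ _ (by rw [o.code_length]; omega), o.code_length]
        congr 1
        omega)
    refine ⟨T + t, σ, hr _ _ h, by rw [hm]; rfl, by rw [h0, hk 0 (by simp)], ?_⟩
    push_cast [List.length_cons]
    linarith

/-- Whatever a list of legal memory operations computes from the input and finite precomputed data is
computed by the interpreter. -/
theorem exists_runs_interpreter {d s : ℕ} {τ : ℝ} (hτ : 1 ≤ τ) (ops : List Op)
    (hv : ∀ o ∈ ops, o.Valid s) (w : List ℝ) (out : ℕ) :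
    ∃ u : List ℕ, ∀ x : Fin d → ℝ, ∃ (t : ℝ) (σ : State),
      Runs s τ interpreter (initial u w x) t σ ∧
      σ.mem = runOps s ops (initial u w x).mem ∧ σ.reg 0 = out ∧
      t ≤ 19 * τ * (ops.length + 1) := by
  -- Cell `0` is the output address, cell `1` points to the current code, cell `2` receives the
  -- opcode, cell `3` is the constant one, cells `4` to `9` receive the operands, and cell `10`
  -- stays zero so that `jumpZero 10` is an unconditional jump.
  refine ⟨[out, 16, 0, 1, 0, 0, 0, 0, 0, 0, 0, 0, 0, 0, 0, 0] ++ ops.flatMap Op.code, fun x => ?_⟩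
  obtain ⟨t, σ, h, hm, h0, ht⟩ := runs_interpreter (s := s) hτ ops
    (reg := fun i => ([out, 16, 0, 1, 0, 0, 0, 0, 0, 0, 0, 0, 0, 0, 0, 0] ++
      ops.flatMap Op.code).getD i 0)
    (mem := fun i => if h : i < d then x ⟨i, h⟩ else w.getD (i - d) 0) (ptr := 16) le_rfl rfl rfl rfl
    hv (fun i => by
      rw [List.getD_append_right _ _ _ _ (by simp)]
      congr 1
      simp)
  exact ⟨t, σ, h, hm, by rw [h0]; rfl, ht⟩

/-! ### Loops and block matrix products by the tensor unit -/

theorem runOps_append (s : ℕ) (l₁ l₂ : List Op) (mem : ℕ → ℝ) :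
    runOps s (l₁ ++ l₂) mem = runOps s l₂ (runOps s l₁ mem) := by
  simp [runOps]

theorem runOps_cons (s : ℕ) (o : Op) (l : List Op) (mem : ℕ → ℝ) :
    runOps s (o :: l) mem = runOps s l (o.apply s mem) := rfl

/-- A loop invariant. -/
theorem runOps_range {s : ℕ} (body : ℕ → List Op) (Inv : ℕ → (ℕ → ℝ) → Prop) (N : ℕ)
    {mem : ℕ → ℝ} (h0 : Inv 0 mem)
    (h : ∀ n < N, ∀ mem, Inv n mem → Inv (n + 1) (runOps s (body n) mem)) :
    Inv N (runOps s ((List.range N).flatMap body) mem) := by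
  induction N with
  | zero => exact h0
  | succ N ih =>
    rw [List.range_succ, List.flatMap_append, runOps_append]
    simpa using h N (by omega) _ (ih fun n hn => h n (by omega))

theorem length_flatMap_range_le (body : ℕ → List Op) (N c : ℕ) (h : ∀ n, (body n).length ≤ c) :
    ((List.range N).flatMap body).length ≤ N * c := by
  induction N with
  | zero => simp
  | succ N ih =>
    rw [List.range_succ, List.flatMap_append, List.length_append]
    have := h N
    simp only [List.flatMap_cons, List.flatMap_nil, List.append_nil]
    linarith [Nat.succ_mul N c]

theorem div_mod_unique {m a a' b b' : ℕ} (hb : b < m) (hb' : b' < m)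
    (h : a * m + b = a' * m + b') : a = a' ∧ b = b' := by
  have h1 : (a * m + b) / m = a := by
    rw [Nat.mul_comm, Nat.mul_add_div (by omega), Nat.div_eq_of_lt hb, Nat.add_zero]
  have h2 : (a' * m + b') / m = a' := by
    rw [Nat.mul_comm, Nat.mul_add_div (by omega), Nat.div_eq_of_lt hb', Nat.add_zero]
  have h3 : a = a' := by rw [← h1, h, h2]
  subst h3
  exact ⟨rfl, by omega⟩

section Multiply

variable {s : ℕ} {mem : ℕ → ℝ} {a lda b ldb c ldc : ℕ}

theorem multiply_apply (hs : s ≤ ldc) {i j : ℕ} (hi : i < s) (hj : j < s) :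
    multiply s mem a lda b ldb c ldc (c + i * ldc + j) =
      ∑ l ∈ Finset.range s, mem (a + i * lda + l) * mem (b + l * ldb + j) := by
  have h1 : c + i * ldc + j - c = ldc * i + j := by rw [Nat.mul_comm]; omega
  have h2 : (ldc * i + j) / ldc = i := by
    rw [Nat.mul_add_div (by omega), Nat.div_eq_of_lt (by omega), Nat.add_zero]
  have h3 : (ldc * i + j) % ldc = j := by
    rw [Nat.mul_add_mod, Nat.mod_eq_of_lt (by omega)]
  unfold multiply
  rw [h1, h2, h3, if_pos ⟨by omega, hi, hj⟩]
  rfl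

theorem multiply_of_ne {p : ℕ} (h : ∀ i < s, ∀ j < s, p ≠ c + i * ldc + j) :
    multiply s mem a lda b ldb c ldc p = mem p := by
  unfold multiply
  refine if_neg ?_
  rintro ⟨h1, h2, h3⟩
  refine h _ h2 _ h3 ?_
  have := Nat.div_add_mod (p - c) ldc
  rw [Nat.mul_comm]
  omega

theorem multiply_of_lt {p : ℕ} (h : p < c) : multiply s mem a lda b ldb c ldc p = mem p :=
  multiply_of_ne fun i _ j _ => by
    have : 0 ≤ i * ldc := Nat.zero_le _
    omega

end Multiply

/-- An `s × s` matrix is stored contiguously at address `p`. -/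
def Holds (s : ℕ) (mem : ℕ → ℝ) (p : ℕ) (A : ℕ → ℕ → ℝ) : Prop :=
  ∀ i < s, ∀ j < s, mem (p + i * s + j) = A i j

theorem mul_add_lt_sq {s i j : ℕ} (hi : i < s) (hj : j < s) : i * s + j < s * s := by
  nlinarith

theorem Holds.congr {s p q : ℕ} {mem mem' : ℕ → ℝ} {A : ℕ → ℕ → ℝ} (h : Holds s mem p A)
    (hq : p + s * s ≤ q) (hm : ∀ a < q, mem' a = mem a) : Holds s mem' p A := fun i hi j hj => by
  rw [hm _ (by have := mul_add_lt_sq hi hj; omega), h i hi j hj]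

/-- The identity matrix. -/
def idMat (i j : ℕ) : ℝ := if i = j then 1 else 0

theorem sum_idMat_mul {s i : ℕ} (hi : i < s) (f : ℕ → ℝ) :
    ∑ l ∈ Finset.range s, idMat i l * f l = f i := by
  rw [Finset.sum_eq_single i]
  · simp [idMat]
  · intro l _ h
    simp [idMat, h.symm]
  · simp [hi]

/-- This is the block copy of the machine: one tensor product moves `s * s` entries and may change
their row spacing. -/
theorem multiply_id {s : ℕ} {mem : ℕ → ℝ} {e b ldb c ldc : ℕ} (he : Holds s mem e idMat)
    (hs : s ≤ ldc) {i j : ℕ} (hi : i < s) (hj : j < s) :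
    multiply s mem e s b ldb c ldc (c + i * ldc + j) = mem (b + i * ldb + j) := by
  rw [multiply_apply hs hi hj, ← sum_idMat_mul hi fun l => mem (b + l * ldb + j)]
  refine Finset.sum_congr rfl fun l hl => ?_
  rw [he i hi l (Finset.mem_range.1 hl)]

/-- The block size for which two blocks fit into the tensor unit, except if `s = 1`. -/
def blk (s : ℕ) : ℕ := if s = 1 then 1 else s / 2

theorem blk_pos {s : ℕ} (hs : 0 < s) : 0 < blk s := by
  unfold blk; split_ifs <;> omega

theorem blk_le (s : ℕ) : blk s ≤ s := by
  unfold blk; split_ifs <;> omega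

/-- The worst case is `s = 3`, where `blk s = 1`. This is where halving the block size costs a
constant factor. -/
theorem le_three_mul_blk (s : ℕ) : s ≤ 3 * blk s := by
  unfold blk; split_ifs <;> omega

/-- The matrix used to add the product of `A` with a block of rows to an accumulator. -/
def accMat (s : ℕ) (A : ℕ → ℕ → ℝ) (i l : ℕ) : ℝ :=
  if s = 1 then A i l else
    if l < blk s then idMat i l else if l < 2 * blk s then A i (l - blk s) else 0

/-- The operations that add the product of a `blk s × blk s` matrix `A`, where `accMat s A` is stored
at `g`, with the block of rows at `β` to the accumulator at `q`. -/
def accOps (s e g β ld q : ℕ) : List Op :=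
  if s = 1 then [.mul g 1 β ld (q + 1) 1, .add q (q + 1) q]
  else [.mul e s β ld (q + blk s * s) s, .mul g s q s q s]

theorem accOps_length (s e g β ld q : ℕ) : (accOps s e g β ld q).length = 2 := by
  unfold accOps; split_ifs <;> rfl

theorem accOps_valid {s e g β ld q : ℕ} : ∀ o ∈ accOps s e g β ld q, o.Valid s := by
  unfold accOps; split_ifs with h <;> simp [Op.Valid, h]

/-- Entrywise addition would take `s * s` unit steps per tensor product. Instead the accumulator is
stacked on a copy of the operand block and multiplied by `[I | A | 0]`, which yields the old
accumulator plus the product; the zero columns annihilate whatever lies in the remaining rows. For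
`s = 1` two blocks do not fit, and one scalar addition does the job. -/
theorem runOps_accOps {s e g β ld q : ℕ} (hs : 0 < s) {A : ℕ → ℕ → ℝ} {mem : ℕ → ℝ}
    (he : Holds s mem e idMat) (hg : Holds s mem g (accMat s A)) (hgq : g + s * s ≤ q)
    (hβ : ∀ l < blk s, ∀ j < s, β + l * ld + j < q) :
    (∀ p < q, runOps s (accOps s e g β ld q) mem p = mem p) ∧
    (∀ p, q + 2 * (s * s) ≤ p → runOps s (accOps s e g β ld q) mem p = mem p) ∧
    ∀ i < blk s, ∀ j < s, runOps s (accOps s e g β ld q) mem (q + i * s + j) =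
      mem (q + i * s + j) + ∑ l ∈ Finset.range (blk s), A i l * mem (β + l * ld + j) := by
  by_cases h1 : s = 1
  · subst h1
    have hb : blk 1 = 1 := rfl
    have hg' := hg 0 one_pos 0 one_pos
    simp only [accMat, if_true, zero_mul, add_zero] at hg'
    have e0 := multiply_apply (mem := mem) (a := g) (lda := 1) (b := β) (ldb := ld) (c := q + 1)
      (le_refl 1) one_pos one_pos
    simp only [Finset.sum_range_one, zero_mul, add_zero] at e0
    refine ⟨fun p hp => ?_, fun p hp => ?_, fun i hi j hj => ?_⟩
    · simp only [accOps, if_true, runOps, List.foldl, Op.apply]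
      rw [Function.update_of_ne (by omega), multiply_of_lt (by omega)]
    · simp only [accOps, if_true, runOps, List.foldl, Op.apply]
      rw [Function.update_of_ne (by omega), multiply_of_ne]
      intro i hi j hj
      have : i = 0 := by omega
      subst this
      omega
    · rw [hb] at hi ⊢
      have : i = 0 := by omega
      subst this
      have : j = 0 := by omega
      subst this
      simp only [accOps, if_true, runOps, List.foldl, Op.apply, zero_mul, add_zero,
        Function.update_self, Finset.sum_range_one]
      rw [multiply_of_lt (by omega), e0, hg']
  · have hb : 2 * blk s ≤ s := by unfold blk; rw [if_neg h1]; omega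
    have hbb : blk s * s + s * s ≤ 2 * (s * s) := by nlinarith
    set mem₁ := multiply s mem e s β ld (q + blk s * s) s with hm₁
    have hacc : accOps s e g β ld q = [.mul e s β ld (q + blk s * s) s, .mul g s q s q s] := by
      unfold accOps; rw [if_neg h1]
    have hrun : runOps s (accOps s e g β ld q) mem = multiply s mem₁ g s q s q s := by
      rw [hacc]; rfl
    have h₁ : ∀ p < q + blk s * s, mem₁ p = mem p := fun p hp => multiply_of_lt hp
    have h₁' : ∀ p, q + 2 * (s * s) ≤ p → mem₁ p = mem p := fun p hp =>
      multiply_of_ne fun i hi j hj => by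
        have := mul_add_lt_sq hi hj
        omega
    have hg₁ : Holds s mem₁ g (accMat s A) := hg.congr hgq fun p hp => h₁ p (by omega)
    rw [hrun]
    refine ⟨fun p hp => ?_, fun p hp => ?_, fun i hi j hj => ?_⟩
    · rw [multiply_of_lt hp, h₁ p (by omega)]
    · rw [multiply_of_ne, h₁' p hp]
      intro i hi j hj
      have := mul_add_lt_sq hi hj
      omega
    · have his : i < s := by omega
      rw [multiply_apply le_rfl his hj]
      have hsplit : Finset.range s = Finset.range (blk s + (blk s + (s - 2 * blk s))) := by
        congr 1; omega
      rw [hsplit, Finset.sum_range_add, Finset.sum_range_add]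
      have t1 : ∑ l ∈ Finset.range (blk s), mem₁ (g + i * s + l) * mem₁ (q + l * s + j) =
          mem (q + i * s + j) := by
        rw [← sum_idMat_mul hi fun l => mem (q + l * s + j)]
        refine Finset.sum_congr rfl fun l hl => ?_
        have hl := Finset.mem_range.1 hl
        rw [hg₁ i his l (by omega), h₁]
        · simp [accMat, h1, hl]
        · have : (l + 1) * s ≤ blk s * s := Nat.mul_le_mul_right s hl
          linarith [Nat.succ_mul l s]
      have t2 : ∑ l ∈ Finset.range (blk s), mem₁ (g + i * s + (blk s + l)) *
          mem₁ (q + (blk s + l) * s + j) =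
          ∑ l ∈ Finset.range (blk s), A i l * mem (β + l * ld + j) := by
        refine Finset.sum_congr rfl fun l hl => ?_
        have hl := Finset.mem_range.1 hl
        rw [hg₁ i his _ (by omega)]
        have : q + (blk s + l) * s + j = q + blk s * s + l * s + j := by ring
        rw [this, hm₁, multiply_id he le_rfl (by omega) hj]
        have h2 : blk s + l < 2 * blk s := by omega
        simp [accMat, h1, h2]
      have t3 : ∑ l ∈ Finset.range (s - 2 * blk s), mem₁ (g + i * s + (blk s + (blk s + l))) *
          mem₁ (q + (blk s + (blk s + l)) * s + j) = 0 := by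
        refine Finset.sum_eq_zero fun l hl => ?_
        have hl := Finset.mem_range.1 hl
        rw [hg₁ i his _ (by omega)]
        have h2 : ¬ blk s + (blk s + l) < 2 * blk s := by omega
        simp [accMat, h1, h2]
      rw [t1, t2, t3, add_zero]

/-- The operations that compute one block of a product of matrices. -/
def blockOps (s e z : ℕ) (g β : ℕ → ℕ) (ld H q c ldc : ℕ) : List Op :=
  .mul z s z s q s :: ((List.range H).flatMap fun h => accOps s e (g h) (β h) ld q) ++
    [.mul e s q s c ldc]

theorem blockOps_length (s e z : ℕ) (g β : ℕ → ℕ) (ld H q c ldc : ℕ) :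
    (blockOps s e z g β ld H q c ldc).length ≤ 2 * H + 2 := by
  have := length_flatMap_range_le (fun h => accOps s e (g h) (β h) ld q) H 2
    fun n => (accOps_length ..).le
  simp only [blockOps, List.length_append, List.length_cons, List.length_nil]
  omega

theorem blockOps_valid {s e z : ℕ} {g β : ℕ → ℕ} {ld H q c ldc : ℕ} (hldc : s ≤ ldc) :
    ∀ o ∈ blockOps s e z g β ld H q c ldc, o.Valid s := by
  intro o ho
  simp only [blockOps, List.cons_append, List.mem_cons, List.mem_append, List.mem_flatMap,
    List.not_mem_nil, or_false] at ho
  rcases ho with rfl | ⟨h, _, ho⟩ | rfl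
  · exact le_refl s
  · exact accOps_valid o ho
  · exact hldc

/-- All operands are read below `q`, and writes go only to scratch in `[q, q + 2 * (s * s))` and to
the target, so the operands survive the loop. The accumulator is cleared by a product of zero
matrices. The final copy writes `s` rows, of which only the first `blk s` are meaningful. -/
theorem runOps_blockOps {s e z : ℕ} {g β : ℕ → ℕ} {ld H q c ldc : ℕ} (hs : 0 < s)
    {A : ℕ → ℕ → ℕ → ℝ} {mem : ℕ → ℝ} (he : Holds s mem e idMat) (hz : Holds s mem z fun _ _ => 0)
    (hg : ∀ h < H, Holds s mem (g h) (accMat s (A h))) (heq : e + s * s ≤ q)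
    (hgq : ∀ h < H, g h + s * s ≤ q)
    (hβ : ∀ h < H, ∀ l < blk s, ∀ j < s, β h + l * ld + j < q) (hc : q + 2 * (s * s) ≤ c)
    (hldc : s ≤ ldc) :
    (∀ p < q, runOps s (blockOps s e z g β ld H q c ldc) mem p = mem p) ∧
    (∀ p, q + 2 * (s * s) ≤ p → (∀ i < s, ∀ j < s, p ≠ c + i * ldc + j) →
      runOps s (blockOps s e z g β ld H q c ldc) mem p = mem p) ∧
    ∀ i < blk s, ∀ j < s, runOps s (blockOps s e z g β ld H q c ldc) mem (c + i * ldc + j) =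
      ∑ h ∈ Finset.range H, ∑ l ∈ Finset.range (blk s), A h i l * mem (β h + l * ld + j) := by
  set mem₀ := multiply s mem z s z s q s with hm₀
  set mem₁ := runOps s ((List.range H).flatMap fun h => accOps s e (g h) (β h) ld q) mem₀ with hm₁
  have hrun : runOps s (blockOps s e z g β ld H q c ldc) mem = multiply s mem₁ e s q s c ldc := by
    simp only [blockOps, List.cons_append, runOps_cons, runOps_append]
    rfl
  have hloop : (∀ p < q, mem₁ p = mem p) ∧ (∀ p, q + 2 * (s * s) ≤ p → mem₁ p = mem p) ∧
      ∀ i < blk s, ∀ j < s, mem₁ (q + i * s + j) =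
        ∑ h ∈ Finset.range H, ∑ l ∈ Finset.range (blk s), A h i l * mem (β h + l * ld + j) := by
    refine runOps_range _ (fun n m => (∀ p < q, m p = mem p) ∧
      (∀ p, q + 2 * (s * s) ≤ p → m p = mem p) ∧
      ∀ i < blk s, ∀ j < s, m (q + i * s + j) =
        ∑ h ∈ Finset.range n, ∑ l ∈ Finset.range (blk s), A h i l * mem (β h + l * ld + j)) H
      ⟨fun p hp => multiply_of_lt hp, fun p hp => multiply_of_ne fun i hi j hj => ?_,
        fun i hi j hj => ?_⟩ fun n hn m hm => ?_
    · have := mul_add_lt_sq hi hj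
      omega
    · rw [hm₀, multiply_apply le_rfl (lt_of_lt_of_le hi (blk_le s)) hj, Finset.sum_range_zero]
      refine Finset.sum_eq_zero fun l hl => ?_
      rw [hz i (lt_of_lt_of_le hi (blk_le s)) l (Finset.mem_range.1 hl), zero_mul]
    · obtain ⟨m1, m2, m3⟩ := hm
      obtain ⟨r1, r2, r3⟩ := runOps_accOps hs (he.congr heq m1) ((hg n hn).congr (hgq n hn) m1)
        (hgq n hn) (hβ n hn)
      refine ⟨fun p hp => by rw [r1 p hp, m1 p hp], fun p hp => by rw [r2 p hp, m2 p hp],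
        fun i hi j hj => ?_⟩
      rw [r3 i hi j hj, m3 i hi j hj, Finset.sum_range_succ]
      congr 1
      refine Finset.sum_congr rfl fun l hl => ?_
      rw [m1 _ (hβ n hn l (Finset.mem_range.1 hl) j hj)]
  obtain ⟨m1, m2, m3⟩ := hloop
  rw [hrun]
  refine ⟨fun p hp => ?_, fun p hp hp' => ?_, fun i hi j hj => ?_⟩
  · rw [multiply_of_lt (by omega), m1 p hp]
  · rw [multiply_of_ne hp', m2 p hp]
  · rw [multiply_id (he.congr heq m1) hldc (lt_of_lt_of_le hi (blk_le s)) hj, m3 i hi j hj]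

/-- The operations that compute the product of an `R × H` block matrix with an `H × J` block
matrix. -/
def productOps (s e z : ℕ) (g : ℕ → ℕ → ℕ) (β : ℕ → ℕ) (ld R J H q : ℕ) : List Op :=
  (List.range (R * J)).flatMap fun n =>
    blockOps s e z (g (n / J)) (fun h => β h + n % J * s) ld H q
      (q + 2 * (s * s) + n / J * blk s * (J * s) + n % J * s) (J * s)

theorem productOps_length (s e z : ℕ) (g : ℕ → ℕ → ℕ) (β : ℕ → ℕ) (ld R J H q : ℕ) :
    (productOps s e z g β ld R J H q).length ≤ R * J * (2 * H + 2) :=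
  length_flatMap_range_le _ _ _ fun _ => blockOps_length ..

theorem productOps_valid {s e z : ℕ} {g : ℕ → ℕ → ℕ} {β : ℕ → ℕ} {ld R J H q : ℕ} :
    ∀ o ∈ productOps s e z g β ld R J H q, o.Valid s := by
  intro o ho
  obtain ⟨n, hn, ho⟩ := List.mem_flatMap.1 ho
  refine blockOps_valid ?_ o ho
  have : J ≠ 0 := by rintro rfl; simp at hn
  exact Nat.le_mul_of_pos_left _ (by omega)

/-- Each block spills `s - blk s` meaningless rows below itself. Since the blocks are produced in
row-major order, the spill only reaches rows that are written later or are not part of the result.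
-/
theorem runOps_productOps {s e z : ℕ} {g : ℕ → ℕ → ℕ} {β : ℕ → ℕ} {ld R J H q : ℕ} (hs : 0 < s)
    {A : ℕ → ℕ → ℕ → ℕ → ℝ} {mem : ℕ → ℝ} (he : Holds s mem e idMat)
    (hz : Holds s mem z fun _ _ => 0)
    (hg : ∀ I < R, ∀ h < H, Holds s mem (g I h) (accMat s (A I h))) (heq : e + s * s ≤ q)
    (hzq : z + s * s ≤ q) (hgq : ∀ I < R, ∀ h < H, g I h + s * s ≤ q)
    (hβ : ∀ h < H, ∀ l < blk s, ∀ j < J * s, β h + l * ld + j < q) :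
    (∀ p < q, runOps s (productOps s e z g β ld R J H q) mem p = mem p) ∧
    ∀ I < R, ∀ i < blk s, ∀ j < J * s,
      runOps s (productOps s e z g β ld R J H q) mem
        (q + 2 * (s * s) + (I * blk s + i) * (J * s) + j) =
      ∑ h ∈ Finset.range H, ∑ l ∈ Finset.range (blk s), A I h i l * mem (β h + l * ld + j) := by
  have hcol : ∀ {J' j : ℕ}, J' < J → j < s → J' * s + j < J * s := fun {J' j} h1 h2 => by
    have : (J' + 1) * s ≤ J * s := Nat.mul_le_mul_right s h1
    linarith [Nat.succ_mul J' s]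
  have hloop : (∀ p < q, runOps s (productOps s e z g β ld R J H q) mem p = mem p) ∧
      ∀ I J' : ℕ, J' < J → I * J + J' < R * J → ∀ i < blk s, ∀ j < s,
        runOps s (productOps s e z g β ld R J H q) mem
          (q + 2 * (s * s) + (I * blk s + i) * (J * s) + (J' * s + j)) =
        ∑ h ∈ Finset.range H, ∑ l ∈ Finset.range (blk s),
          A I h i l * mem (β h + l * ld + (J' * s + j)) := by
    refine runOps_range _ (fun n m => (∀ p < q, m p = mem p) ∧
      ∀ I J' : ℕ, J' < J → I * J + J' < n → ∀ i < blk s, ∀ j < s,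
        m (q + 2 * (s * s) + (I * blk s + i) * (J * s) + (J' * s + j)) =
        ∑ h ∈ Finset.range H, ∑ l ∈ Finset.range (blk s),
          A I h i l * mem (β h + l * ld + (J' * s + j))) (R * J)
      ⟨fun p hp => rfl, fun I J' _ h => by omega⟩ fun n hn m hm => ?_
    obtain ⟨m1, m2⟩ := hm
    have hJ : 0 < J := by
      rcases Nat.eq_zero_or_pos J with rfl | h
      · simp at hn
      · exact h
    have hI : n / J < R := (Nat.div_lt_iff_lt_mul hJ).2 hn
    have hJn : n % J < J := Nat.mod_lt _ hJ
    have hβ' : ∀ h < H, ∀ l < blk s, ∀ j < s, β h + n % J * s + l * ld + j < q :=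
      fun h hh l hl j hj => by
        have := hβ h hh l hl _ (hcol hJn hj)
        omega
    obtain ⟨r1, r2, r3⟩ := runOps_blockOps (β := fun h => β h + n % J * s) (ld := ld)
      (c := q + 2 * (s * s) + n / J * blk s * (J * s) + n % J * s) (ldc := J * s) hs
      (he.congr heq m1) (hz.congr hzq m1)
      (fun h hh => (hg _ hI h hh).congr (hgq _ hI h hh) m1) heq (hgq _ hI) hβ'
      (by rw [Nat.add_assoc]; exact Nat.le_add_right _ _) (Nat.le_mul_of_pos_left _ hJ)
    refine ⟨fun p hp => by rw [r1 p hp, m1 p hp], fun I J' hJ' hlt i hi j hj => ?_⟩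
    rcases Nat.lt_succ_iff_lt_or_eq.1 hlt with hlt | heqn
    · rw [r2, m2 I J' hJ' hlt i hi j hj]
      · rw [Nat.add_assoc]; exact Nat.le_add_right _ _
      · intro i' hi' j' hj' hp
        have h1 : (I * blk s + i) * (J * s) + (J' * s + j) =
            (n / J * blk s + i') * (J * s) + (n % J * s + j') := by
          rw [Nat.add_mul (n / J * blk s)]
          omega
        obtain ⟨h2, h3⟩ := div_mod_unique (hcol hJ' hj) (hcol hJn hj') h1
        obtain ⟨h4, -⟩ := div_mod_unique hj hj' h3
        -- A finished block that shares its block column with the current one lies in a strictly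
        -- earlier block row, hence above every row being written.
        have h5 : I < n / J := by
          by_contra hcon
          have : n / J * J ≤ I * J := Nat.mul_le_mul_right J (by omega)
          have := Nat.div_add_mod n J
          rw [Nat.mul_comm] at this
          omega
        have : (I + 1) * blk s ≤ n / J * blk s := Nat.mul_le_mul_right _ h5
        rw [Nat.succ_mul] at this
        omega
    · obtain ⟨h2, h3⟩ := div_mod_unique hJ' hJn (by
        rw [heqn, Nat.mul_comm, Nat.div_add_mod] : I * J + J' = n / J * J + n % J)
      subst h2 h3
      have := r3 i hi j hj
      rw [show q + 2 * (s * s) + (n / J * blk s + i) * (J * s) + (n % J * s + j) =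
        q + 2 * (s * s) + n / J * blk s * (J * s) + n % J * s + i * (J * s) + j by ring, this]
      refine Finset.sum_congr rfl fun h hh => Finset.sum_congr rfl fun l hl => ?_
      rw [m1 _ (hβ' h (Finset.mem_range.1 hh) l (Finset.mem_range.1 hl) j hj)]
      congr 2
      ring
  refine ⟨hloop.1, fun I hI i hi j hj => ?_⟩
  have hjs : j / s < J := (Nat.div_lt_iff_lt_mul hs).2 hj
  have := hloop.2 I (j / s) hjs (by
    have : (I + 1) * J ≤ R * J := Nat.mul_le_mul_right J hI
    rw [Nat.succ_mul] at this
    omega) i hi (j % s) (Nat.mod_lt _ hs)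
  rwa [show j / s * s + j % s = j by rw [Nat.mul_comm, Nat.div_add_mod]] at this

/-! ### Precomputed data and products of arbitrary size -/

/-- The list `W` is stored at address `p`. -/
def HoldsList (mem : ℕ → ℝ) (p : ℕ) (W : List ℝ) : Prop :=
  ∀ i < W.length, mem (p + i) = W.getD i 0

theorem HoldsList.left {mem : ℕ → ℝ} {p : ℕ} {W₁ W₂ : List ℝ} (h : HoldsList mem p (W₁ ++ W₂)) :
    HoldsList mem p W₁ := fun i hi => by
  rw [h i (by rw [List.length_append]; omega), List.getD_append _ _ _ _ hi]

theorem HoldsList.right {mem : ℕ → ℝ} {p : ℕ} {W₁ W₂ : List ℝ} (h : HoldsList mem p (W₁ ++ W₂)) :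
    HoldsList mem (p + W₁.length) W₂ := fun i hi => by
  rw [Nat.add_assoc, h _ (by rw [List.length_append]; omega),
    List.getD_append_right _ _ _ _ (by omega), Nat.add_sub_cancel_left]

theorem HoldsList.congr {mem mem' : ℕ → ℝ} {p q : ℕ} {W : List ℝ} (h : HoldsList mem p W)
    (hq : p + W.length ≤ q) (hm : ∀ a < q, mem' a = mem a) : HoldsList mem' p W := fun i hi => by
  rw [hm _ (by omega), h i hi]

/-- The list of the entries of `n` matrices of size `s × s`. -/
def matList (s n : ℕ) (A : ℕ → ℕ → ℕ → ℝ) : List ℝ :=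
  (List.range (n * (s * s))).map fun t => A (t / (s * s)) (t % (s * s) / s) (t % (s * s) % s)

theorem matList_length (s n : ℕ) (A : ℕ → ℕ → ℕ → ℝ) : (matList s n A).length = n * (s * s) := by
  simp [matList]

theorem HoldsList.holds {mem : ℕ → ℝ} {p s n : ℕ} {A : ℕ → ℕ → ℕ → ℝ}
    (h : HoldsList mem p (matList s n A)) {t : ℕ} (ht : t < n) :
    Holds s mem (p + t * (s * s)) (A t) := fun i hi j hj => by
  have h1 := mul_add_lt_sq hi hj
  have h2 : t * (s * s) + (i * s + j) < n * (s * s) := by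
    have : (t + 1) * (s * s) ≤ n * (s * s) := Nat.mul_le_mul_right _ ht
    rw [Nat.succ_mul] at this
    omega
  have h3 := h (t * (s * s) + (i * s + j)) (by rw [matList_length]; exact h2)
  rw [show p + t * (s * s) + i * s + j = p + (t * (s * s) + (i * s + j)) by ring, h3]
  have e1 : (t * (s * s) + (i * s + j)) / (s * s) = t := by
    rw [Nat.mul_comm, Nat.mul_add_div (by omega), Nat.div_eq_of_lt h1, Nat.add_zero]
  have e2 : (t * (s * s) + (i * s + j)) % (s * s) = i * s + j := by
    rw [Nat.mul_comm, Nat.mul_add_mod, Nat.mod_eq_of_lt h1]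
  have e3 : (i * s + j) / s = i := by
    rw [Nat.mul_comm, Nat.mul_add_div (by omega), Nat.div_eq_of_lt hj, Nat.add_zero]
  have e4 : (i * s + j) % s = j := by
    rw [Nat.mul_comm, Nat.mul_add_mod, Nat.mod_eq_of_lt hj]
  unfold matList
  rw [List.getD_eq_getElem _ _ (by simpa using h2)]
  simp only [List.getElem_map, List.getElem_range, e1, e2, e3, e4]

theorem sum_range_mul {M : Type*} [AddCommMonoid M] (a b : ℕ) (f : ℕ → M) :
    ∑ n ∈ Finset.range (a * b), f n =
      ∑ i ∈ Finset.range a, ∑ j ∈ Finset.range b, f (i * b + j) := by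
  induction a with
  | zero => simp
  | succ a ih => rw [Nat.succ_mul, Finset.sum_range_add, ih, Finset.sum_range_succ]

theorem lt_div_succ_mul {p b : ℕ} (hb : 0 < b) : p < (p / b + 1) * b := by
  have := Nat.div_add_mod p b
  have := Nat.mod_lt p hb
  rw [Nat.succ_mul, Nat.mul_comm]
  omega

/-- The number of operations used for the product of a `ρ × (G p)` matrix with a matrix that has
`J` columns of blocks. -/
def productCost (s ρ G p J : ℕ) : ℕ :=
  (ρ / blk s + 1) * J * (2 * (G * (p / blk s + 1)) + 2)

/-- The product of a fixed matrix with a matrix in memory, whose rows are stored in `G` groups of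
`p` rows. -/
theorem exists_ops_product {s : ℕ} (hs : 0 < s) (A : ℕ → ℕ → ℝ) (ρ G p J : ℕ) :
    ∃ W : List ℝ, ∀ P q a o ld : ℕ, P + W.length ≤ q →
      (∀ g < G, ∀ h < (p / blk s + 1) * blk s, ∀ j < J * s, a + g * o + h * ld + j < q) →
      ∃ ops : List Op, (∀ o ∈ ops, o.Valid s) ∧ ops.length ≤ productCost s ρ G p J ∧
        ∀ mem, HoldsList mem P W → (∀ x < q, runOps s ops mem x = mem x) ∧
          ∀ i < ρ, ∀ j < J * s, runOps s ops mem (q + 2 * (s * s) + i * (J * s) + j) =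
            ∑ g ∈ Finset.range G, ∑ h ∈ Finset.range p,
              A i (g * p + h) * mem (a + g * o + h * ld + j) := by
  set b := blk s with hb
  have hb0 : 0 < b := blk_pos hs
  set R := ρ / b + 1
  set H₀ := p / b + 1 with hH₀
  have hH₀0 : 0 < H₀ := Nat.succ_pos _
  set H := G * H₀ with hH
  -- Each group of `p` rows is rounded up to `H₀` blocks. The fixed factor is zero in the surplus
  -- positions, so it is harmless that the rows read there hold unrelated data.
  let B : ℕ → ℕ → ℕ → ℕ → ℝ := fun I h i l =>
    if h % H₀ * b + l < p then A (I * b + i) (h / H₀ * p + (h % H₀ * b + l)) else 0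
  let D : ℕ → ℕ → ℕ → ℝ := fun t => accMat s (B (t / H) (t % H))
  refine ⟨matList s 1 (fun _ => idMat) ++ (matList s 1 (fun _ _ _ => 0) ++ matList s (R * H) D),
    fun P q a o ld hPq hread => ?_⟩
  simp only [List.length_append, matList_length, one_mul] at hPq
  have hgidx : ∀ I < R, ∀ h < H, I * H + h < R * H := fun I hI h hh => by
    have : (I + 1) * H ≤ R * H := Nat.mul_le_mul_right _ hI
    rw [Nat.succ_mul] at this
    omega
  refine ⟨productOps s P (P + s * s) (fun I h => P + s * s + s * s + (I * H + h) * (s * s))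
    (fun h => a + h / H₀ * o + h % H₀ * b * ld) ld R J H q, productOps_valid,
    productOps_length .., fun mem hmem => ?_⟩
  have he := hmem.left.holds one_pos
  have hz := hmem.right.left.holds one_pos
  have hD := fun t ht => hmem.right.right.holds (t := t) ht
  simp only [matList_length, one_mul, zero_mul, add_zero] at he hz hD
  have hdm : ∀ h < H, h / H₀ < G ∧ h % H₀ < H₀ := fun h hh =>
    ⟨(Nat.div_lt_iff_lt_mul hH₀0).2 hh, Nat.mod_lt _ hH₀0⟩
  have hrow : ∀ {h l : ℕ}, h < H₀ → l < b → h * b + l < H₀ * b := fun {h l} hh hl => by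
    have : (h + 1) * b ≤ H₀ * b := Nat.mul_le_mul_right _ hh
    rw [Nat.succ_mul] at this
    omega
  obtain ⟨r1, r2⟩ := runOps_productOps (s := s) (e := P) (z := P + s * s)
    (g := fun I h => P + s * s + s * s + (I * H + h) * (s * s))
    (β := fun h => a + h / H₀ * o + h % H₀ * b * ld) (ld := ld) (R := R) (J := J) (H := H) (q := q)
    hs (A := B) (mem := mem) he hz (fun I hI h hh => by
      have := hD (I * H + h) (hgidx I hI h hh)
      have e1 : (I * H + h) / H = I := by
        rw [Nat.mul_comm, Nat.mul_add_div (by omega), Nat.div_eq_of_lt hh, Nat.add_zero]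
      have e2 : (I * H + h) % H = h := by rw [Nat.mul_comm, Nat.mul_add_mod, Nat.mod_eq_of_lt hh]
      simpa only [D, e1, e2] using this) (by omega) (by omega)
    (fun I hI h hh => by
      have : (I * H + h + 1) * (s * s) ≤ R * H * (s * s) := Nat.mul_le_mul_right _ (hgidx I hI h hh)
      rw [Nat.succ_mul] at this
      omega)
    (fun h hh l hl j hj => by
      obtain ⟨h1, h2⟩ := hdm h hh
      have := hread _ h1 _ (hrow h2 hl) j hj
      rw [Nat.add_mul] at this
      omega)
  refine ⟨r1, fun i hi j hj => ?_⟩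
  have hiR : i / b < R := Nat.lt_succ_of_le (Nat.div_le_div_right hi.le)
  have := r2 (i / b) hiR (i % b) (Nat.mod_lt _ hb0) j hj
  rw [show i / blk s * blk s + i % b = i by rw [Nat.mul_comm, hb, Nat.div_add_mod]] at this
  rw [this, hH, sum_range_mul]
  refine Finset.sum_congr rfl fun g _ => ?_
  have e1 : ∀ h < H₀, (g * H₀ + h) / H₀ = g := fun h hh => by
    rw [Nat.mul_comm, Nat.mul_add_div hH₀0, Nat.div_eq_of_lt hh, Nat.add_zero]
  have e2 : ∀ h < H₀, (g * H₀ + h) % H₀ = h := fun h hh => by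
    rw [Nat.mul_comm, Nat.mul_add_mod, Nat.mod_eq_of_lt hh]
  let f : ℕ → ℝ := fun t => if t < p then A i (g * p + t) * mem (a + g * o + t * ld + j) else 0
  have h1 : ∑ h ∈ Finset.range H₀, ∑ l ∈ Finset.range b, B (i / b) (g * H₀ + h) (i % b) l *
      mem (a + (g * H₀ + h) / H₀ * o + (g * H₀ + h) % H₀ * b * ld + l * ld + j) =
      ∑ t ∈ Finset.range (H₀ * b), f t := by
    rw [sum_range_mul]
    refine Finset.sum_congr rfl fun h hh => Finset.sum_congr rfl fun l _ => ?_
    have hh := Finset.mem_range.1 hh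
    simp only [B, f, e1 h hh, e2 h hh, ite_mul, zero_mul]
    rw [show i / b * b + i % b = i by rw [Nat.mul_comm, Nat.div_add_mod],
      show a + g * o + h * b * ld + l * ld + j = a + g * o + (h * b + l) * ld + j by ring]
  rw [h1]
  have hp : p < H₀ * b := lt_div_succ_mul hb0
  rw [show H₀ * b = p + (H₀ * b - p) by omega, Finset.sum_range_add]
  have h2 : ∑ t ∈ Finset.range (H₀ * b - p), f (p + t) = 0 :=
    Finset.sum_eq_zero fun t _ => by simp [f]
  rw [h2, add_zero]
  refine Finset.sum_congr rfl fun t ht => ?_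
  simp [f, Finset.mem_range.1 ht]

/-! ### Transposing a column -/

/-- The operations that move `s` entries of a column into consecutive cells. -/
def rowOps (s z e₁ o a ld q c ldc : ℕ) : List Op :=
  [.mul z s z s q s, .mul a ld e₁ s q (s + 1), .mul o s q s c ldc]

/-- The first column is isolated by a product with the matrix unit at `(0, 0)` and stored with row
spacing `s + 1`. Reread with spacing `s` it forms a diagonal matrix, the background having been
cleared before. The all-ones matrix times this diagonal has the column as each of its rows. -/
theorem runOps_rowOps {s z e₁ o a ld q c ldc : ℕ} (hs : 0 < s) {mem : ℕ → ℝ}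
    (hz : Holds s mem z fun _ _ => 0)
    (he : Holds s mem e₁ fun i j => if i = 0 ∧ j = 0 then 1 else 0)
    (ho : Holds s mem o fun _ _ => 1) (heq : e₁ + s * s ≤ q)
    (hoq : o + s * s ≤ q) (ha : ∀ i < s, a + i * ld < q) (hc : q + 2 * (s * s) ≤ c)
    (hldc : s ≤ ldc) :
    (∀ p < q, runOps s (rowOps s z e₁ o a ld q c ldc) mem p = mem p) ∧
    (∀ p, q + 2 * (s * s) ≤ p → (∀ i < s, ∀ j < s, p ≠ c + i * ldc + j) →
      runOps s (rowOps s z e₁ o a ld q c ldc) mem p = mem p) ∧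
    ∀ i < s, runOps s (rowOps s z e₁ o a ld q c ldc) mem (c + i) = mem (a + i * ld) := by
  set mem₁ := multiply s mem z s z s q s with hm₁
  set mem₂ := multiply s mem₁ a ld e₁ s q (s + 1) with hm₂
  have hrun : runOps s (rowOps s z e₁ o a ld q c ldc) mem = multiply s mem₂ o s q s c ldc := rfl
  have h₁ : ∀ p < q, mem₁ p = mem p := fun p hp => multiply_of_lt hp
  have h₂ : ∀ p < q, mem₂ p = mem p := fun p hp => by rw [hm₂, multiply_of_lt hp, h₁ p hp]
  have h₂' : ∀ p, q + 2 * (s * s) ≤ p → mem₂ p = mem p := fun p hp => by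
    rw [hm₂, multiply_of_ne, hm₁, multiply_of_ne]
    · intro i hi j hj
      have := mul_add_lt_sq hi hj
      omega
    · intro i hi j hj
      have := mul_add_lt_sq hi hj
      have h3 : s ≤ s * s := Nat.le_mul_self s
      rw [Nat.mul_succ]
      omega
  have hzero : ∀ i < s, ∀ j < s, mem₁ (q + i * s + j) = 0 := fun i hi j hj => by
    rw [hm₁, multiply_apply le_rfl hi hj]
    exact Finset.sum_eq_zero fun l hl => by rw [hz i hi l (Finset.mem_range.1 hl), zero_mul]
  have he₁ := he.congr heq h₁
  have hval : ∀ i < s, ∀ j < s, mem₂ (q + i * (s + 1) + j) =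
      if j = 0 then mem (a + i * ld) else 0 := fun i hi j hj => by
    rw [hm₂, multiply_apply (by omega) hi hj, Finset.sum_eq_single 0]
    · rw [he₁ 0 hs j hj]
      by_cases hj0 : j = 0
      · simp [hj0, h₁ _ (ha i hi)]
      · simp [hj0]
    · intro l hl hl0
      rw [he₁ l (Finset.mem_range.1 hl) j hj]
      simp [hl0]
    · simp [hs.ne']
  have hdiag : ∀ i < s, ∀ j < s, mem₂ (q + i * s + j) = if i = j then mem (a + j * ld) else 0 := by
    intro i hi j hj
    by_cases hij : i = j
    · subst hij
      rw [if_pos rfl, show q + i * s + i = q + i * (s + 1) + 0 by ring, hval i hi 0 hs, if_pos rfl]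
    · rw [if_neg hij]
      by_cases hp : ∃ i' < s, ∃ j' < s, q + i * s + j = q + i' * (s + 1) + j'
      · obtain ⟨i', hi', j', hj', h⟩ := hp
        rw [h, hval i' hi' j' hj', if_neg]
        rintro rfl
        obtain ⟨h1, h2⟩ := div_mod_unique hj hi' (by rw [Nat.mul_succ] at h; omega :
          i * s + j = i' * s + i')
        omega
      · push Not at hp
        rw [hm₂, multiply_of_ne hp, hzero i hi j hj]
  rw [hrun]
  refine ⟨fun p hp => by rw [multiply_of_lt (by omega), h₂ p hp],
    fun p hp hp' => by rw [multiply_of_ne hp', h₂' p hp], fun i hi => ?_⟩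
  have := multiply_apply (mem := mem₂) (a := o) (lda := s) (b := q) (ldb := s) (c := c) hldc hs hi
  rw [Nat.zero_mul, Nat.add_zero] at this
  rw [this, Finset.sum_eq_single i]
  · rw [hdiag i hi i hi, if_pos rfl]
    rw [(ho.congr hoq h₂) 0 hs i hi, one_mul]
  · intro l hl hli
    rw [hdiag l (Finset.mem_range.1 hl) i hi, if_neg hli, mul_zero]
  · simp [hi]

/-- A column in memory can be moved into consecutive cells. -/
theorem exists_ops_row {s : ℕ} (hs : 0 < s) (k : ℕ) :
    ∃ W : List ℝ, ∀ P q a ld : ℕ, P + W.length ≤ q → (∀ i < (k / s + 1) * s, a + i * ld < q) →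
      ∃ ops : List Op, (∀ o ∈ ops, o.Valid s) ∧ ops.length ≤ 3 * (k / s + 1) ∧
        ∀ mem, HoldsList mem P W → 
          ∀ i < k, runOps s ops mem (q + 2 * (s * s) + i) = mem (a + i * ld) := by
  set N := k / s + 1
  refine ⟨matList s 1 (fun _ _ _ => 0) ++ (matList s 1 (fun _ i j => if i = 0 ∧ j = 0 then 1 else 0)
    ++ matList s 1 fun _ _ _ => 1), fun P q a ld hPq ha => ?_⟩
  simp only [List.length_append, matList_length, one_mul] at hPq
  -- Only the first row of each product is wanted. The row spacing `N * s` sends the other rows past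
  -- the whole output.
  set body : ℕ → List Op := fun I => rowOps s P (P + s * s) (P + s * s + s * s) (a + I * s * ld) ld q
    (q + 2 * (s * s) + I * s) (N * s) with hbody
  have hN : s ≤ N * s := Nat.le_mul_of_pos_left _ (Nat.succ_pos _)
  refine ⟨(List.range N).flatMap body, ?_, ?_, fun mem hmem => ?_⟩
  · intro o ho
    obtain ⟨n, hn, ho⟩ := List.mem_flatMap.1 ho
    simp only [hbody, rowOps, List.mem_cons, List.not_mem_nil, or_false] at ho
    rcases ho with rfl | rfl | rfl
    · exact le_refl s
    · exact Nat.le_succ s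
    · exact hN
  · rw [Nat.mul_comm]
    exact length_flatMap_range_le _ _ _ fun n => le_rfl
  have hz := hmem.left.holds one_pos
  have he := hmem.right.left.holds one_pos
  have ho := hmem.right.right.holds one_pos
  simp only [matList_length, one_mul, zero_mul, add_zero] at he hz ho
  have hidx : ∀ {I i : ℕ}, I < N → i < s → I * s + i < N * s := fun {I i} hI hi => by
    have : (I + 1) * s ≤ N * s := Nat.mul_le_mul_right _ hI
    rw [Nat.succ_mul] at this
    omega
  have hloop := runOps_range (s := s) body (fun n m => (∀ p < q, m p = mem p) ∧
      ∀ i < n * s, m (q + 2 * (s * s) + i) = mem (a + i * ld)) N (mem := mem)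
    ⟨fun _ _ => rfl, fun i hi => by omega⟩ fun n hn m hm => by
      obtain ⟨m1, m2⟩ := hm
      have ha' : ∀ i < s, a + n * s * ld + i * ld < q := fun i hi => by
        have := ha _ (hidx hn hi)
        rw [Nat.add_mul] at this
        omega
      obtain ⟨r1, r2, r3⟩ := runOps_rowOps (a := a + n * s * ld) (ld := ld)
        (c := q + 2 * (s * s) + n * s) (ldc := N * s) hs (hz.congr (by omega) m1)
        (he.congr (by omega) m1) (ho.congr (by omega) m1) (by omega) (by omega) ha'
        (Nat.le_add_right _ _) hN
      refine ⟨fun p hp => by rw [r1 p hp, m1 p hp], fun i hi => ?_⟩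
      by_cases hin : i < n * s
      · rw [r2 _ (Nat.le_add_right _ _), m2 i hin]
        intro i' hi' j' hj' hp
        rcases Nat.eq_zero_or_pos i' with rfl | hpos
        · omega
        · have : 1 * (N * s) ≤ i' * (N * s) := Nat.mul_le_mul_right _ hpos
          have : n * s ≤ N * s := Nat.mul_le_mul_right _ hn.le
          omega
      · obtain ⟨i', rfl⟩ : ∃ i', i = n * s + i' := ⟨i - n * s, by omega⟩
        rw [Nat.succ_mul] at hi
        have hi' : i' < s := by omega
        rw [← Nat.add_assoc, r3 i' hi', m1 _ (ha' i' hi'), Nat.add_mul, Nat.add_assoc]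
  exact fun i hi => hloop.2 i (hi.trans (lt_div_succ_mul hs))

/-! ### The sketch and its execution -/

/-- The linear map that halves the number of columns of a matrix with `p` rows and `2 ^ j` columns
`j` times, by a product of the matrix `A i` with the matrix that has the right half of the columns
below the left half, and finally multiplies the remaining column by `Af`. -/
noncomputable def chain (r : ℕ) (Af : ℕ → ℕ → ℝ) (A : ℕ → ℕ → ℕ → ℝ) :
    ℕ → ℕ → (ℕ → ℕ → ℝ) → ℕ → ℝ
  | 0, p, Y => fun i => ∑ h ∈ Finset.range p, Af i h * Y h 0
  | j + 1, p, Y => chain r Af A j r fun i c =>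
      ∑ g ∈ Finset.range 2, ∑ h ∈ Finset.range p, A j i (g * p + h) * Y h (c + g * 2 ^ j)

theorem chain_congr (r : ℕ) (Af : ℕ → ℕ → ℝ) (A : ℕ → ℕ → ℕ → ℝ) (j : ℕ) :
    ∀ (p : ℕ) {Y Y' : ℕ → ℕ → ℝ}, (∀ h < p, ∀ c < 2 ^ j, Y h c = Y' h c) →
      chain r Af A j p Y = chain r Af A j p Y' := by
  induction j with
  | zero =>
    intro p Y Y' h
    funext i
    exact Finset.sum_congr rfl fun h' hh => by rw [h h' (Finset.mem_range.1 hh) 0 (by simp)]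
  | succ j ih =>
    intro p Y Y' h
    refine ih r fun i _ c hc => Finset.sum_congr rfl fun g hg => Finset.sum_congr rfl fun h' hh => ?_
    rw [h h' (Finset.mem_range.1 hh)]
    have : g ≤ 1 := Nat.lt_succ_iff.1 (Finset.mem_range.1 hg)
    have : g * 2 ^ j ≤ 1 * 2 ^ j := Nat.mul_le_mul_right _ this
    rw [pow_succ]
    omega

theorem chain_congr_left (r : ℕ) (Af : ℕ → ℕ → ℝ) {A A' : ℕ → ℕ → ℕ → ℝ} (j : ℕ) :
    ∀ (p : ℕ) (Y : ℕ → ℕ → ℝ), (∀ l < j, A l = A' l) →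
      chain r Af A j p Y = chain r Af A' j p Y := by
  induction j with
  | zero => intro p Y _; rfl
  | succ j ih =>
    intro p Y h
    simp only [chain]
    rw [ih _ _ fun l hl => h l (by omega), h j (by omega)]

theorem chain_add (r : ℕ) (Af : ℕ → ℕ → ℝ) (A : ℕ → ℕ → ℕ → ℝ) (j : ℕ) :
    ∀ (p : ℕ) (Y Y' : ℕ → ℕ → ℝ), chain r Af A j p (fun h c => Y h c + Y' h c) =
      chain r Af A j p Y + chain r Af A j p Y' := by
  induction j with
  | zero => intro p Y Y'; funext i; simp [chain, mul_add, Finset.sum_add_distrib]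
  | succ j ih =>
    intro p Y Y'
    simp only [chain]
    rw [← ih]
    simp only [mul_add, Finset.sum_add_distrib]

theorem chain_smul (r : ℕ) (Af : ℕ → ℕ → ℝ) (A : ℕ → ℕ → ℕ → ℝ) (j : ℕ) :
    ∀ (p : ℕ) (t : ℝ) (Y : ℕ → ℕ → ℝ), chain r Af A j p (fun h c => t * Y h c) =
      t • chain r Af A j p Y := by
  induction j with
  | zero => intro p t Y; funext i; simp [chain, Finset.mul_sum, mul_left_comm]
  | succ j ih =>
    intro p t Y
    simp only [chain]
    rw [← ih]
    simp only [Finset.mul_sum, mul_left_comm]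

/-- The number of operations used to compute `chain`. -/
def chainCost (s k r : ℕ) : ℕ → ℕ → ℕ
  | 0, p => productCost s k 1 p 1 + 3 * (k / s + 1)
  | j + 1, p => productCost s r 2 p (2 ^ j / s + 1) + chainCost s k r j r

/-- Folding costs no operation: the two halves are read in place as two groups of rows at offset `2
^ j`. The data `W` is chosen before the addresses, since the working area `q` must begin after the
data of all levels. The last level also transposes, because the output has to be contiguous. -/
theorem exists_ops_chain {s : ℕ} (hs : 0 < s) (k r : ℕ) (Af : ℕ → ℕ → ℝ) (A : ℕ → ℕ → ℕ → ℝ)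
    (j : ℕ) : ∀ p : ℕ, ∃ W : List ℝ, ∀ P q a ld : ℕ, P + W.length ≤ q →
      (∀ h < (p / blk s + 1) * blk s, ∀ c < 2 ^ j + s, a + h * ld + c < q) →
      ∃ (ops : List Op) (out : ℕ), (∀ o ∈ ops, o.Valid s) ∧ ops.length ≤ chainCost s k r j p ∧
        ∀ mem, HoldsList mem P W →
          ∀ i < k, runOps s ops mem (out + i) = chain r Af A j p (fun h c => mem (a + h * ld + c)) i := by
  induction j with
  | zero =>
    intro p
    obtain ⟨W₁, h₁⟩ := exists_ops_product hs Af k 1 p 1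
    obtain ⟨W₂, h₂⟩ := exists_ops_row hs k
    refine ⟨W₁ ++ W₂, fun P q a ld hPq hread => ?_⟩
    rw [List.length_append] at hPq
    obtain ⟨ops₁, v₁, l₁, r₁⟩ := h₁ P q a 0 ld (by omega) fun g _ h hh c hc => by
      have := hread h hh c (by omega)
      omega
    set q' := q + 2 * (s * s) + (k / s + 1) * s * (1 * s) + 1 with hq'
    obtain ⟨ops₂, v₂, l₂, r₂⟩ := h₂ (P + W₁.length) q' (q + 2 * (s * s)) (1 * s) (by omega)
      fun i hi => by
        have : i * (1 * s) ≤ (k / s + 1) * s * (1 * s) := Nat.mul_le_mul_right _ hi.le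
        omega
    refine ⟨ops₁ ++ ops₂, q' + 2 * (s * s), ?_, ?_, fun mem hmem i hi => ?_⟩
    · simp only [List.mem_append]
      rintro o (ho | ho)
      exacts [v₁ o ho, v₂ o ho]
    · rw [List.length_append]
      exact add_le_add l₁ l₂
    · obtain ⟨f₁, g₁⟩ := r₁ mem hmem.left
      rw [runOps_append, r₂ _ (hmem.right.congr (by omega) f₁) i hi]
      have := g₁ i hi 0 (by omega)
      rw [Nat.add_zero] at this
      rw [this]
      simp [chain]
  | succ j ih =>
    intro p
    -- Enough block columns to cover all `2 ^ j` columns; the surplus ones contain values that later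
    -- levels never use, by `chain_congr`.
    set J := 2 ^ j / s + 1 with hJ
    have hJ1 : 2 ^ j < J * s := lt_div_succ_mul hs
    have hJ2 : J * s ≤ 2 ^ j + s := by
      rw [hJ, Nat.succ_mul]
      have := Nat.div_mul_le_self (2 ^ j) s
      omega
    obtain ⟨W₁, h₁⟩ := exists_ops_product hs (A j) r 2 p J
    obtain ⟨W₂, h₂⟩ := ih r
    refine ⟨W₁ ++ W₂, fun P q a ld hPq hread => ?_⟩
    rw [List.length_append] at hPq
    obtain ⟨ops₁, v₁, l₁, r₁⟩ := h₁ P q a (2 ^ j) ld (by omega) fun g hg h hh c hc => by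
      have h3 : g * 2 ^ j ≤ 1 * 2 ^ j := Nat.mul_le_mul_right _ (by omega)
      have := hread h hh (g * 2 ^ j + c) (by rw [pow_succ]; omega)
      omega
    set q' := q + 2 * (s * s) + (r / blk s + 1) * blk s * (J * s) + (2 ^ j + s) with hq'
    obtain ⟨ops₂, out, v₂, l₂, r₂⟩ := h₂ (P + W₁.length) q' (q + 2 * (s * s)) (J * s) (by omega)
      fun h hh c hc => by
        have : h * (J * s) ≤ (r / blk s + 1) * blk s * (J * s) := Nat.mul_le_mul_right _ hh.le
        omega
    refine ⟨ops₁ ++ ops₂, out, ?_, ?_, fun mem hmem i hi => ?_⟩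
    · simp only [List.mem_append]
      rintro o (ho | ho)
      exacts [v₁ o ho, v₂ o ho]
    · rw [List.length_append]
      exact add_le_add l₁ l₂
    · obtain ⟨f₁, g₁⟩ := r₁ mem hmem.left
      rw [runOps_append, r₂ _ (hmem.right.congr (by omega) f₁) i hi]
      simp only [chain]
      refine congrFun (chain_congr r Af A j r fun h hh c hc => ?_) i
      rw [g₁ h hh c (by omega)]
      refine Finset.sum_congr rfl fun g _ => Finset.sum_congr rfl fun h' _ => ?_
      rw [show a + g * 2 ^ j + h' * ld + c = a + h' * ld + (c + g * 2 ^ j) by ring]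

/-- The view of a vector as a matrix with `2 ^ S` columns, row by row, padded with zeros. -/
noncomputable def view {d : ℕ} (S : ℕ) (x : Fin d → ℝ) (h c : ℕ) : ℝ :=
  if hd : h * 2 ^ S + c < d then x ⟨h * 2 ^ S + c, hd⟩ else 0

/-- The linear map that multiplies a vector, viewed as a matrix with `2 ^ S` columns, by `A₀`, and
then applies `chain`. -/
noncomputable def sketch (k r S : ℕ) (A₀ Af : ℕ → ℕ → ℝ) (A : ℕ → ℕ → ℕ → ℝ) {d : ℕ} (x : Fin d → ℝ) :
    ℕ → ℝ :=
  chain r Af A S k fun i c => ∑ h ∈ Finset.range (d / 2 ^ S + 1), A₀ i h * view S x h c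

/-- The number of operations used to compute `sketch`. -/
def sketchCost (s d k r S : ℕ) : ℕ :=
  productCost s k 1 (d / 2 ^ S + 1) (2 ^ S / s + 1) + chainCost s k r S k

theorem exists_ops_sketch {s : ℕ} (hs : 0 < s) (d k r S : ℕ) (A₀ Af : ℕ → ℕ → ℝ)
    (A : ℕ → ℕ → ℕ → ℝ) :
    ∃ (W : List ℝ) (ops : List Op) (out : ℕ), (∀ o ∈ ops, o.Valid s) ∧
      ops.length ≤ sketchCost s d k r S ∧ ∀ (u : List ℕ) (x : Fin d → ℝ),
        ∀ i < k, runOps s ops (initial u W x).mem (out + i) = sketch k r S A₀ Af A x i := by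
  set N := d / 2 ^ S + 1 with hN
  set J := 2 ^ S / s + 1 with hJ
  have hJ1 : 2 ^ S < J * s := lt_div_succ_mul hs
  obtain ⟨W₁, h₁⟩ := exists_ops_product hs A₀ k 1 N J
  obtain ⟨W₂, h₂⟩ := exists_ops_chain hs k r Af A S k
  set P := N * 2 ^ S with hP
  have hdP : d < P := lt_div_succ_mul (by positivity)
  have h2S : 0 < 2 ^ S := by positivity
  set q := P + (W₁.length + W₂.length) + (N / blk s + 1) * blk s * 2 ^ S + J * s with hq
  set q' := q + 2 * (s * s) + (k / blk s + 1) * blk s * (J * s) + (2 ^ S + s) with hq'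
  obtain ⟨ops₁, v₁, l₁, r₁⟩ := h₁ P q 0 0 (2 ^ S) (by omega) fun g _ h hh c hc => by
    have : h * 2 ^ S ≤ (N / blk s + 1) * blk s * 2 ^ S := Nat.mul_le_mul_right _ hh.le
    omega
  obtain ⟨ops₂, out, v₂, l₂, r₂⟩ := h₂ (P + W₁.length) q' (q + 2 * (s * s)) (J * s) (by omega)
    fun h hh c hc => by
      have : h * (J * s) ≤ (k / blk s + 1) * blk s * (J * s) := Nat.mul_le_mul_right _ hh.le
      omega
  -- The zeros fill the gap between the end of the input and `P`, so that memory from address `0`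
  -- on, read with row spacing `2 ^ S`, is exactly `view S x`.
  refine ⟨List.replicate (P - d) 0 ++ (W₁ ++ W₂), ops₁ ++ ops₂, out, ?_, ?_, fun u x i hi => ?_⟩
  · simp only [List.mem_append]
    rintro o (ho | ho)
    exacts [v₁ o ho, v₂ o ho]
  · rw [List.length_append]
    exact add_le_add l₁ l₂
  · set mem := (initial u (List.replicate (P - d) 0 ++ (W₁ ++ W₂)) x).mem with hm
    have hmem : HoldsList mem P (W₁ ++ W₂) := fun i hi => by
      simp only [hm, initial]
      rw [dif_neg (by omega), List.getD_append_right _ _ _ _ (by simp; omega)]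
      congr 1
      simp
      omega
    obtain ⟨f₁, g₁⟩ := r₁ mem hmem.left
    rw [runOps_append, r₂ _ (hmem.right.congr (by omega) f₁) i hi]
    refine congrFun (chain_congr r Af A S k fun h hh c hc => ?_) i
    rw [g₁ h hh c (by omega), Finset.sum_range_one]
    refine Finset.sum_congr rfl fun h' hh' => ?_
    have hlt : h' * 2 ^ S + c < P := by
      have : (h' + 1) * 2 ^ S ≤ N * 2 ^ S := Nat.mul_le_mul_right _ (Finset.mem_range.1 hh')
      rw [Nat.succ_mul] at this
      omega
    simp only [zero_mul, zero_add]
    congr 1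
    simp only [hm, initial, view]
    by_cases hd : h' * 2 ^ S + c < d
    · rw [dif_pos hd, dif_pos hd]
    · rw [dif_neg hd, dif_neg hd, List.getD_append _ _ _ _ (by simp; omega)]
      rw [List.getD_replicate _ (by omega)]

/-! ### Moments of sign sums -/

open scoped BigOperators

section Expect

variable {α β : Type*} [Fintype α] [Fintype β]

theorem expect_prod_type (f : α × β → ℝ) : 𝔼 x, f x = 𝔼 a, 𝔼 b, f (a, b) := by
  rw [← Finset.univ_product_univ, Finset.expect_product]

theorem expect_cons {n : ℕ} (f : (Fin (n + 1) → α) → ℝ) :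
    𝔼 ξ, f ξ = 𝔼 a, 𝔼 ξ, f (Fin.cons a ξ) := by
  rw [← expect_prod_type fun x : α × (Fin n → α) => f (Fin.cons x.1 x.2)]
  exact (Fintype.expect_equiv (Fin.consEquiv fun _ => α) _ _ fun x => rfl).symm

theorem expect_fin_sum [Nonempty α] (f : α → ℝ) (n : ℕ) :
    𝔼 ξ : Fin n → α, ∑ i, f (ξ i) = n * 𝔼 a, f a := by
  induction n with
  | zero => simp
  | succ n ih =>
    rw [expect_cons]
    simp only [Fin.sum_univ_succ, Fin.cons_zero, Fin.cons_succ, Finset.expect_add_distrib,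
      Fintype.expect_const, ih]
    push_cast
    ring

theorem expect_fin_prod (f : α → ℝ) (n : ℕ) :
    𝔼 ξ : Fin n → α, ∏ i, f (ξ i) = (𝔼 a, f a) ^ n := by
  rw [Finset.expect_pow, Fintype.piFinset_univ]

end Expect

/-- The sign encoded by a Boolean. -/
noncomputable def sgn (b : Bool) : ℝ := if b then 1 else -1

theorem expect_bool (f : Bool → ℝ) : 𝔼 b, f b = (f true + f false) / 2 := by
  rw [Fintype.expect_eq_sum_div_card]
  simp

theorem expect_sign_sum_sq {n : ℕ} (a : Fin n → ℝ) :
    𝔼 ξ : Fin n → Bool, (∑ h, sgn (ξ h) * a h) ^ 2 = ∑ h, a h ^ 2 := by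
  have key : ∀ {n : ℕ} (a : Fin n → ℝ) (z : ℝ),
      𝔼 ξ : Fin n → Bool, (z + ∑ h, sgn (ξ h) * a h) ^ 2 = z ^ 2 + ∑ h, a h ^ 2 := by
    intro n
    induction n with
    | zero => intro a z; simp
    | succ n ih =>
      intro a z
      rw [expect_cons]
      simp only [Fin.sum_univ_succ, Fin.cons_zero, Fin.cons_succ, ← add_assoc, ih]
      rw [expect_bool]
      simp only [sgn, if_true, Bool.false_eq_true, if_false]
      ring
  simpa using key a 0

/-- Averaging over the sign leaves `cosh (2 * l * z * a)`, which is at most `exp (2 * l² * z² *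
a²)`. The result is again the exponential of a quadratic in `z`, so signs can be integrated out one
at a time. -/
theorem exp_sq_sign_le (l z a : ℝ) :
    (Real.exp (l * (z + a) ^ 2) + Real.exp (l * (z - a) ^ 2)) / 2 ≤
      Real.exp (l * a ^ 2 + l * (1 + 2 * l * a ^ 2) * z ^ 2) := by
  have h1 : (Real.exp (l * (z + a) ^ 2) + Real.exp (l * (z - a) ^ 2)) / 2 =
      Real.exp (l * z ^ 2 + l * a ^ 2) * Real.cosh (2 * l * z * a) := by
    rw [Real.cosh_eq, mul_div_assoc', mul_add, ← Real.exp_add, ← Real.exp_add]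
    ring_nf
  rw [h1]
  refine (mul_le_mul_of_nonneg_left (Real.cosh_le_exp_half_sq _) (Real.exp_pos _).le).trans ?_
  rw [← Real.exp_add, Real.exp_le_exp]
  apply le_of_eq
  ring

theorem expect_exp_sign_sum_sq {n : ℕ} (a : Fin n → ℝ) {l : ℝ} (hl : 0 ≤ l)
    (hla : 4 * l * ∑ h, a h ^ 2 ≤ 1) :
    𝔼 ξ : Fin n → Bool, Real.exp (l * (∑ h, sgn (ξ h) * a h) ^ 2) ≤
      Real.exp (2 * l * ∑ h, a h ^ 2) := by
  have key : ∀ {n : ℕ} (a : Fin n → ℝ) (z : ℝ), 4 * l * ∑ h, a h ^ 2 ≤ 1 →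
      𝔼 ξ : Fin n → Bool, Real.exp (l * (z + ∑ h, sgn (ξ h) * a h) ^ 2) ≤
        Real.exp (2 * l * ∑ h, a h ^ 2 + l / (1 - 2 * l * ∑ h, a h ^ 2) * z ^ 2) := by
    intro n
    induction n with
    | zero => intro a z _; simp
    | succ n ih =>
      intro a z hla
      rw [expect_cons]
      simp only [Fin.sum_univ_succ, Fin.cons_zero, Fin.cons_succ, ← add_assoc] at hla ⊢
      set σ := ∑ h : Fin n, a h.succ ^ 2 with hσ
      have hσ0 : 0 ≤ σ := Finset.sum_nonneg fun _ _ => sq_nonneg _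
      have ha0 := sq_nonneg (a 0)
      have hlσ : 4 * l * σ ≤ 1 := by nlinarith [mul_nonneg hl ha0]
      have h1 : ∀ b : Bool, 𝔼 ξ : Fin n → Bool,
          Real.exp (l * (z + sgn b * a 0 + ∑ h, sgn (ξ h) * a h.succ) ^ 2) ≤
          Real.exp (2 * l * σ) * Real.exp (l / (1 - 2 * l * σ) * (z + sgn b * a 0) ^ 2) :=
        fun b => by
          rw [← Real.exp_add]
          exact ih _ _ hlσ
      refine (Finset.expect_le_expect fun b _ => h1 b).trans ?_
      rw [← Finset.mul_expect, expect_bool]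
      simp only [sgn, if_true, Bool.false_eq_true, if_false, one_mul, neg_mul, ← sub_eq_add_neg]
      have hd : 0 < 1 - 2 * l * σ := by linarith
      set l₁ := l / (1 - 2 * l * σ) with hl₁
      have hl₁0 : 0 ≤ l₁ := by positivity
      have hl₁' : l₁ * (1 - 2 * l * σ) = l := div_mul_cancel₀ _ hd.ne'
      have hl₁2 : l₁ ≤ 2 * l := by nlinarith
      refine (mul_le_mul_of_nonneg_left (exp_sq_sign_le _ _ _) (Real.exp_pos _).le).trans ?_
      rw [← Real.exp_add, Real.exp_le_exp]
      have hd' : 0 < 1 - 2 * l * (a 0 ^ 2 + σ) := by linarith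
      -- The coefficient `l / (1 - 2 * l * σ)` is stable under adding one more sign because the
      -- denominator factors and `(1 + u) * (1 - u) ≤ 1`.
      have h2 : l₁ * (1 + 2 * l₁ * a 0 ^ 2) ≤ l / (1 - 2 * l * (a 0 ^ 2 + σ)) := by
        rw [le_div_iff₀ hd']
        have h3 : 1 - 2 * l * (a 0 ^ 2 + σ) = (1 - 2 * l * σ) * (1 - 2 * l₁ * a 0 ^ 2) := by
          linear_combination 2 * a 0 ^ 2 * hl₁'
        rw [h3]
        have : l₁ * (1 + 2 * l₁ * a 0 ^ 2) * ((1 - 2 * l * σ) * (1 - 2 * l₁ * a 0 ^ 2)) =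
          (l₁ * (1 - 2 * l * σ)) * (1 - (2 * l₁ * a 0 ^ 2) ^ 2) := by ring
        rw [this, hl₁']
        nlinarith [mul_nonneg hl (sq_nonneg (2 * l₁ * a 0 ^ 2))]
      have h4 := mul_le_mul_of_nonneg_right h2 (sq_nonneg z)
      have h5 := mul_le_mul_of_nonneg_right hl₁2 ha0
      linarith
  simpa using key a 0 hla

/-- The squared norm of the product of a row of signs with a matrix. -/
noncomputable def rowSq {p : ℕ} (C : ℕ) (Y : Fin p → ℕ → ℝ) (ξ : Fin p → Bool) : ℝ :=
  ∑ c ∈ Finset.range C, (∑ h, sgn (ξ h) * Y h c) ^ 2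

theorem rowSq_nonneg {p : ℕ} (C : ℕ) (Y : Fin p → ℕ → ℝ) (ξ : Fin p → Bool) : 0 ≤ rowSq C Y ξ :=
  Finset.sum_nonneg fun _ _ => sq_nonneg _

theorem expect_rowSq {p : ℕ} (C : ℕ) (Y : Fin p → ℕ → ℝ) :
    𝔼 ξ, rowSq C Y ξ = ∑ c ∈ Finset.range C, ∑ h, Y h c ^ 2 := by
  unfold rowSq
  rw [Finset.expect_sum_comm]
  exact Finset.sum_congr rfl fun c _ => expect_sign_sum_sq _

/-- The columns share their signs and are dependent. Jensen's inequality, weighted by the squared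
column norms `w c`, which sum to `1`, reduces to single columns, each with `l = 1 / (4 * w c)`, the
largest parameter that `expect_exp_sign_sum_sq` admits. -/
theorem expect_exp_rowSq {p : ℕ} {C : ℕ} {Y : Fin p → ℕ → ℝ}
    (hY : ∑ c ∈ Finset.range C, ∑ h, Y h c ^ 2 = 1) :
    𝔼 ξ, Real.exp (rowSq C Y ξ / 4) ≤ Real.exp (1 / 2) := by
  set w : ℕ → ℝ := fun c => ∑ h, Y h c ^ 2 with hw
  have hw0 : ∀ c, 0 ≤ w c := fun c => Finset.sum_nonneg fun _ _ => sq_nonneg _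
  have hzero : ∀ c, w c = 0 → ∀ ξ : Fin p → Bool, ∑ h, sgn (ξ h) * Y h c = 0 := fun c hc ξ => by
    refine Finset.sum_eq_zero fun h _ => ?_
    have := (Finset.sum_eq_zero_iff_of_nonneg fun h _ => sq_nonneg (Y h c)).1 hc h
      (Finset.mem_univ h)
    rw [pow_eq_zero_iff two_ne_zero] at this
    rw [this, mul_zero]
  have h1 : ∀ ξ : Fin p → Bool, Real.exp (rowSq C Y ξ / 4) ≤
      ∑ c ∈ Finset.range C, w c * Real.exp ((4 * w c)⁻¹ * (∑ h, sgn (ξ h) * Y h c) ^ 2) := by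
    intro ξ
    have := convexOn_exp.map_sum_le (t := Finset.range C) (w := w)
      (p := fun c => (4 * w c)⁻¹ * (∑ h, sgn (ξ h) * Y h c) ^ 2) (fun c _ => hw0 c) hY
      (fun _ _ => Set.mem_univ _)
    simp only [smul_eq_mul] at this
    refine le_trans (le_of_eq ?_) this
    congr 1
    rw [rowSq, Finset.sum_div]
    refine Finset.sum_congr rfl fun c _ => ?_
    by_cases hc : w c = 0
    · rw [hzero c hc, hc]; simp
    · field_simp
  refine (Finset.expect_le_expect fun ξ _ => h1 ξ).trans ?_
  rw [Finset.expect_sum_comm]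
  have h2 : ∀ c ∈ Finset.range C, 𝔼 ξ : Fin p → Bool, w c *
      Real.exp ((4 * w c)⁻¹ * (∑ h, sgn (ξ h) * Y h c) ^ 2) ≤ w c * Real.exp (1 / 2) := by
    intro c _
    rw [← Finset.mul_expect]
    refine mul_le_mul_of_nonneg_left ?_ (hw0 c)
    by_cases hc : w c = 0
    · simp only [hzero c hc]
      simp
    · have hc' : 0 < w c := lt_of_le_of_ne (hw0 c) (Ne.symm hc)
      refine (expect_exp_sign_sum_sq _ (by positivity) ?_).trans ?_
      · apply le_of_eq
        change 4 * (4 * w c)⁻¹ * w c = 1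
        field_simp
      · rw [Real.exp_le_exp]
        apply le_of_eq
        change 2 * (4 * w c)⁻¹ * w c = 1 / 2
        field_simp
        norm_num
  refine (Finset.sum_le_sum h2).trans ?_
  rw [← Finset.sum_mul, hY, one_mul]

theorem exp_le_one_add_add (x : ℝ) : Real.exp x ≤ 1 + x + x ^ 2 * Real.exp |x| := by
  have h := Complex.norm_exp_sub_sum_le_norm_mul_exp (x : ℂ) 2
  simp only [Finset.sum_range_succ, Finset.sum_range_zero, pow_zero, pow_one, Nat.factorial,
    Nat.cast_one, div_one, zero_add, Complex.norm_real, Real.norm_eq_abs, mul_one, sq_abs] at h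
  have h2 : Complex.exp x - (1 + x) = ((Real.exp x - (1 + x) : ℝ) : ℂ) := by push_cast; ring
  rw [h2, Complex.norm_real, Real.norm_eq_abs] at h
  linarith [le_abs_self (Real.exp x - (1 + x))]

theorem one_add_sq_div_two_le_cosh (x : ℝ) : 1 + x ^ 2 / 2 ≤ Real.cosh x := by
  have := sum_le_hasSum (Finset.range 2)
    (fun n _ => div_nonneg (Even.pow_nonneg (even_two_mul n) x) (Nat.cast_nonneg _))
    (Real.hasSum_cosh x)
  simpa [Finset.sum_range_succ] using this

theorem exp_three_quarters_le : Real.exp (3 / 4) ≤ 300 / 128 := by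
  have h1 : Real.exp (3 / 4) ^ 4 ≤ (300 / 128 : ℝ) ^ 4 := by
    rw [← Real.exp_nat_mul]
    have h2 : Real.exp ((4 : ℕ) * (3 / 4)) = Real.exp 1 ^ 3 := by
      rw [← Real.exp_nat_mul]; norm_num
    rw [h2]
    have h3 := Real.exp_one_lt_d9
    calc Real.exp 1 ^ 3 ≤ (2.7182818286 : ℝ) ^ 3 := pow_le_pow_left₀ (Real.exp_pos _).le h3.le 3
      _ ≤ _ := by norm_num
  exact le_of_pow_le_pow_left₀ (by norm_num) (by norm_num) h1

/-- In a second order expansion the linear term has mean zero. The remainder is bounded by `t²`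
times an exponential moment, using `x² / 2 ≤ exp x` at `x = |V - 1| / 8`; the constant comes from
`128 * exp (3 / 4) ≤ 300`. -/
theorem expect_exp_mul_rowSq_sub {p : ℕ} {C : ℕ} {Y : Fin p → ℕ → ℝ}
    (hY : ∑ c ∈ Finset.range C, ∑ h, Y h c ^ 2 = 1) {t : ℝ} (ht : |t| ≤ 1 / 8) :
    𝔼 ξ, Real.exp (t * (rowSq C Y ξ - 1)) ≤ Real.exp (300 * t ^ 2) := by
  have h1 : ∀ ξ : Fin p → Bool, Real.exp (t * (rowSq C Y ξ - 1)) ≤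
      1 + t * (rowSq C Y ξ - 1) +
        t ^ 2 * (128 * Real.exp (1 / 4)) * Real.exp (rowSq C Y ξ / 4) := by
    intro ξ
    set V := rowSq C Y ξ
    have hV : 0 ≤ V := rowSq_nonneg C Y ξ
    have h2 : |V - 1| ≤ V + 1 := abs_le.2 ⟨by linarith, by linarith⟩
    have h3 : (V - 1) ^ 2 ≤ 128 * Real.exp (|V - 1| / 8) := by
      have := Real.quadratic_le_exp_of_nonneg (x := |V - 1| / 8) (by positivity)
      have h4 := abs_nonneg (V - 1)
      nlinarith [sq_abs (V - 1)]
    have h5 : Real.exp |t * (V - 1)| ≤ Real.exp (|V - 1| / 8) := by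
      rw [Real.exp_le_exp, abs_mul]
      nlinarith [abs_nonneg (V - 1)]
    have h6 : Real.exp (|V - 1| / 8) * Real.exp (|V - 1| / 8) ≤
        Real.exp (1 / 4) * Real.exp (V / 4) := by
      rw [← Real.exp_add, ← Real.exp_add, Real.exp_le_exp]
      linarith
    refine (exp_le_one_add_add _).trans ?_
    have h7 : (t * (V - 1)) ^ 2 * Real.exp |t * (V - 1)| ≤
        t ^ 2 * ((128 * Real.exp (|V - 1| / 8)) * Real.exp (|V - 1| / 8)) := by
      rw [mul_pow, mul_assoc]
      exact mul_le_mul_of_nonneg_left (mul_le_mul h3 h5 (Real.exp_pos _).le (by positivity))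
        (sq_nonneg t)
    have h8 := mul_le_mul_of_nonneg_left h6 (by positivity : 0 ≤ t ^ 2 * 128)
    linarith
  refine (Finset.expect_le_expect fun ξ _ => h1 ξ).trans ?_
  rw [Finset.expect_add_distrib, Finset.expect_add_distrib, Fintype.expect_const,
    ← Finset.mul_expect, Finset.expect_sub_distrib, expect_rowSq, hY, Fintype.expect_const,
    ← Finset.mul_expect, sub_self, mul_zero, add_zero]
  have h2 := mul_le_mul_of_nonneg_left (expect_exp_rowSq hY)
    (by positivity : 0 ≤ t ^ 2 * (128 * Real.exp (1 / 4)))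
  have h3 : Real.exp (1 / 4) * Real.exp (1 / 2) ≤ 300 / 128 := by
    rw [← Real.exp_add]
    convert exp_three_quarters_le using 2
    norm_num
  have h4 := mul_le_mul_of_nonneg_left h3 (by positivity : 0 ≤ t ^ 2 * 128)
  linarith [Real.add_one_le_exp (300 * t ^ 2)]

theorem expect_exp_mul_rowSq {p : ℕ} (C : ℕ) (Y : Fin p → ℕ → ℝ) {t : ℝ}
    (ht : |t| * ∑ c ∈ Finset.range C, ∑ h, Y h c ^ 2 ≤ 1 / 8) :
    𝔼 ξ, Real.exp (t * rowSq C Y ξ) ≤ Real.exp (t * (∑ c ∈ Finset.range C, ∑ h, Y h c ^ 2) +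
      300 * (t * ∑ c ∈ Finset.range C, ∑ h, Y h c ^ 2) ^ 2) := by
  set N := ∑ c ∈ Finset.range C, ∑ h, Y h c ^ 2 with hN
  have hN0 : 0 ≤ N := Finset.sum_nonneg fun _ _ => Finset.sum_nonneg fun _ _ => sq_nonneg _
  rcases hN0.eq_or_lt with h0 | hpos
  · have hz : ∀ ξ, rowSq C Y ξ = 0 := fun ξ => by
      refine Finset.sum_eq_zero fun c hc => ?_
      have h1 := (Finset.sum_eq_zero_iff_of_nonneg fun c _ => Finset.sum_nonneg
        fun h _ => sq_nonneg (Y h c)).1 h0.symm c hc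
      have : ∑ h, sgn (ξ h) * Y h c = 0 := Finset.sum_eq_zero fun h _ => by
        have h2 := (Finset.sum_eq_zero_iff_of_nonneg fun h _ => sq_nonneg (Y h c)).1 h1 h
          (Finset.mem_univ h)
        rw [pow_eq_zero_iff two_ne_zero] at h2
        rw [h2, mul_zero]
      rw [this]; simp
    simp [hz, ← h0]
  · have hsN : (Real.sqrt N) ^ 2 = N := Real.sq_sqrt hN0
    have h1 : ∑ c ∈ Finset.range C, ∑ h, (Y h c / Real.sqrt N) ^ 2 = 1 := by
      simp only [div_pow, hsN, ← Finset.sum_div]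
      exact div_self hpos.ne'
    have h2 : ∀ ξ, rowSq C (fun h c => Y h c / Real.sqrt N) ξ = rowSq C Y ξ / N := fun ξ => by
      simp only [rowSq, mul_div_assoc', ← Finset.sum_div, div_pow, hsN]
    have h3 := expect_exp_mul_rowSq_sub h1 (t := t * N) (by rwa [abs_mul, abs_of_pos hpos])
    simp only [h2] at h3
    have h4 : ∀ ξ, Real.exp (t * rowSq C Y ξ) =
        Real.exp (t * N) * Real.exp (t * N * (rowSq C Y ξ / N - 1)) := fun ξ => by
      rw [← Real.exp_add]
      congr 1
      field_simp
      ring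
    simp only [h4]
    rw [← Finset.mul_expect, Real.exp_add]
    exact mul_le_mul_of_nonneg_left h3 (Real.exp_pos _).le

/-! ### A single sign matrix -/

/-- The random matrix with entries `±1 / √ρ`. -/
noncomputable def signMat {ρ p : ℕ} (ξ : Fin ρ → Fin p → Bool) (i h : ℕ) : ℝ :=
  if H : i < ρ ∧ h < p then sgn (ξ ⟨i, H.1⟩ ⟨h, H.2⟩) / Real.sqrt ρ else 0

/-- The squared Frobenius norm of the first `p` rows and `C` columns. -/
def frobSq (p C : ℕ) (Y : ℕ → ℕ → ℝ) : ℝ :=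
  ∑ h ∈ Finset.range p, ∑ c ∈ Finset.range C, Y h c ^ 2

theorem frobSq_nonneg (p C : ℕ) (Y : ℕ → ℕ → ℝ) : 0 ≤ frobSq p C Y :=
  Finset.sum_nonneg fun _ _ => Finset.sum_nonneg fun _ _ => sq_nonneg _

/-- The product of the matrix with entries `±1 / √ρ` with a matrix. -/
noncomputable def signMul {ρ p : ℕ} (ξ : Fin ρ → Fin p → Bool) (Y : ℕ → ℕ → ℝ) (i c : ℕ) : ℝ :=
  ∑ h ∈ Finset.range p, signMat ξ i h * Y h c

theorem frobSq_signMul {ρ p : ℕ} (C : ℕ) (ξ : Fin ρ → Fin p → Bool) (Y : ℕ → ℕ → ℝ) :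
    frobSq ρ C (signMul ξ Y) = ∑ i, rowSq C (fun h c => Y h c) (ξ i) / ρ := by
  rw [frobSq, Finset.sum_range]
  refine Finset.sum_congr rfl fun i _ => ?_
  rw [rowSq, Finset.sum_div]
  refine Finset.sum_congr rfl fun c _ => ?_
  rw [signMul, Finset.sum_range]
  have : ∀ h : Fin p, signMat ξ i h * Y h c = (sgn (ξ i h) * Y h c) / Real.sqrt ρ := fun h => by
    simp only [signMat, i.2, h.2, and_self, dif_pos, Fin.eta]
    ring
  simp only [this]
  rw [← Finset.sum_div, div_pow, Real.sq_sqrt (Nat.cast_nonneg _)]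

theorem sum_fin_eq_frobSq (p C : ℕ) (Y : ℕ → ℕ → ℝ) :
    ∑ c ∈ Finset.range C, ∑ h : Fin p, Y h c ^ 2 = frobSq p C Y := by
  rw [Finset.sum_comm]
  exact (Finset.sum_range fun h => ∑ c ∈ Finset.range C, Y h c ^ 2).symm

theorem expect_frobSq_signMul {ρ : ℕ} (hρ : 0 < ρ) (p C : ℕ) (Y : ℕ → ℕ → ℝ) :
    𝔼 ξ : Fin ρ → Fin p → Bool, frobSq ρ C (signMul ξ Y) = frobSq p C Y := by
  simp only [frobSq_signMul]
  rw [expect_fin_sum (fun a => rowSq C (fun (h : Fin p) c => Y h c) a / ρ), ← Finset.expect_div,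
    expect_rowSq, sum_fin_eq_frobSq]
  have : (ρ : ℝ) ≠ 0 := by positivity
  field_simp

/-- The rows are independent and each contributes with parameter `t / ρ`. Taking the `ρ`-th power
restores the linear term and divides the quadratic one by `ρ`. -/
theorem expect_exp_frobSq_signMul {ρ : ℕ} (hρ : 0 < ρ) (p C : ℕ) (Y : ℕ → ℕ → ℝ) {t : ℝ}
    (ht : |t| * frobSq p C Y ≤ ρ / 8) :
    𝔼 ξ : Fin ρ → Fin p → Bool, Real.exp (t * frobSq ρ C (signMul ξ Y)) ≤
      Real.exp (t * frobSq p C Y + 300 * (t * frobSq p C Y) ^ 2 / ρ) := by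
  have hρ' : (0 : ℝ) < ρ := by positivity
  simp only [frobSq_signMul, Finset.mul_sum, Real.exp_sum]
  rw [expect_fin_prod fun a => Real.exp (t * (rowSq C (fun (h : Fin p) c => Y h c) a / ρ))]
  have h1 := expect_exp_mul_rowSq (p := p) C (fun h c => Y h c) (t := t / ρ) (by
    rw [sum_fin_eq_frobSq, abs_div, abs_of_pos hρ', div_mul_eq_mul_div, div_le_iff₀ hρ']
    linarith)
  rw [sum_fin_eq_frobSq] at h1
  have h2 : ∀ a : Fin p → Bool, t * (rowSq C (fun h c => Y h c) a / ρ) =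
    t / ρ * rowSq C (fun h c => Y h c) a := fun a => by ring
  simp only [h2]
  refine (pow_le_pow_left₀ (Finset.expect_nonneg fun _ _ => (Real.exp_pos _).le) h1 ρ).trans ?_
  rw [← Real.exp_nat_mul, Real.exp_le_exp]
  apply le_of_eq
  field_simp

theorem expect_sq_frobSq_signMul {ρ : ℕ} (hρ : 0 < ρ) (p C : ℕ) (Y : ℕ → ℕ → ℝ) :
    𝔼 ξ : Fin ρ → Fin p → Bool, frobSq ρ C (signMul ξ Y) ^ 2 ≤
      (1 + 1100 / ρ) * frobSq p C Y ^ 2 := by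
  set N := frobSq p C Y with hN
  have hρ' : (0 : ℝ) < ρ := by positivity
  have hρ1 : (1 : ℝ) ≤ ρ := by exact_mod_cast hρ
  have hmean : 𝔼 ξ : Fin ρ → Fin p → Bool, frobSq ρ C (signMul ξ Y) = N :=
    expect_frobSq_signMul hρ p C Y
  rcases (frobSq_nonneg p C Y).eq_or_lt with h0 | hpos
  · have hz : ∀ ξ : Fin ρ → Fin p → Bool, frobSq ρ C (signMul ξ Y) = 0 := fun ξ => by
      have h1 : 𝔼 ξ : Fin ρ → Fin p → Bool, frobSq ρ C (signMul ξ Y) = 0 := by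
        rw [hmean, hN, ← h0]
      rw [Fintype.expect_eq_sum_div_card, div_eq_zero_iff] at h1
      rcases h1 with h1 | h1
      · exact (Finset.sum_eq_zero_iff_of_nonneg fun ξ _ => frobSq_nonneg _ _ _).1 h1 ξ
          (Finset.mem_univ ξ)
      · simp at h1
    simp [hz, hN, ← h0]
  -- This makes the quadratic term `300 * (t * N)² / ρ` equal to `1`. With `x² / 2 ≤ cosh x - 1` it
  -- bounds the variance by `600 * (exp 1 - 1) * N² / ρ`, and `600 * (exp 1 - 1) ≤ 1100`.
  set t := Real.sqrt (ρ / 300) / N with ht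
  have htN : t * N = Real.sqrt (ρ / 300) := div_mul_cancel₀ _ hpos.ne'
  have hsq : (t * N) ^ 2 = ρ / 300 := by rw [htN, Real.sq_sqrt (by positivity)]
  have ht0 : 0 < t := by positivity
  have hle : t * N ≤ ρ / 8 := by
    rw [htN, Real.sqrt_le_left (by positivity)]
    nlinarith
  have e1 := expect_exp_frobSq_signMul hρ p C Y (t := t) (by rwa [abs_of_pos ht0])
  have e2 := expect_exp_frobSq_signMul hρ p C Y (t := -t) (by rwa [abs_neg, abs_of_pos ht0])
  rw [← hN] at e1 e2
  have e3 : 300 * (t * N) ^ 2 / ρ = 1 := by rw [hsq]; field_simp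
  have e3' : 300 * (-t * N) ^ 2 / ρ = 1 := by rw [neg_mul, neg_sq, e3]
  rw [e3] at e1
  rw [e3'] at e2
  have hvar : 𝔼 ξ : Fin ρ → Fin p → Bool, t ^ 2 * (frobSq ρ C (signMul ξ Y) - N) ^ 2 ≤
      2 * (Real.exp 1 - 1) := by
    have h1 : ∀ ξ : Fin ρ → Fin p → Bool, t ^ 2 * (frobSq ρ C (signMul ξ Y) - N) ^ 2 ≤
        Real.exp (-(t * N)) * Real.exp (t * frobSq ρ C (signMul ξ Y)) +
          Real.exp (t * N) * Real.exp (-t * frobSq ρ C (signMul ξ Y)) - 2 := fun ξ => by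
      set F := frobSq ρ C (signMul ξ Y)
      have h2 := one_add_sq_div_two_le_cosh (t * (F - N))
      rw [Real.cosh_eq] at h2
      rw [← Real.exp_add, ← Real.exp_add,
        show -(t * N) + t * F = t * (F - N) by ring, show t * N + -t * F = -(t * (F - N)) by ring]
      linarith [mul_pow t (F - N) 2]
    refine (Finset.expect_le_expect fun ξ _ => h1 ξ).trans ?_
    rw [Finset.expect_sub_distrib, Finset.expect_add_distrib, ← Finset.mul_expect,
      ← Finset.mul_expect, Fintype.expect_const]
    have h3 := mul_le_mul_of_nonneg_left e1 (Real.exp_pos (-(t * N))).le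
    have h4 := mul_le_mul_of_nonneg_left e2 (Real.exp_pos (t * N)).le
    rw [← Real.exp_add] at h3 h4
    rw [show -(t * N) + (t * N + 1) = 1 by ring] at h3
    rw [show t * N + (-t * N + 1) = 1 by ring] at h4
    linarith
  have hexp := Real.exp_one_lt_d9
  have h5 : ∀ ξ : Fin ρ → Fin p → Bool, frobSq ρ C (signMul ξ Y) ^ 2 =
      (t ^ 2)⁻¹ * (t ^ 2 * (frobSq ρ C (signMul ξ Y) - N) ^ 2) +
        (2 * N * frobSq ρ C (signMul ξ Y) - N ^ 2) := fun ξ => by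
    have : t ^ 2 ≠ 0 := by positivity
    field_simp
    ring
  have hmean' : 𝔼 ξ : Fin ρ → Fin p → Bool, 2 * N * frobSq ρ C (signMul ξ Y) = 2 * N * N := by
    rw [← Finset.mul_expect, hmean]
  simp only [h5]
  rw [Finset.expect_add_distrib, ← Finset.mul_expect, Finset.expect_sub_distrib, hmean',
    Fintype.expect_const]
  have h6 : (t ^ 2)⁻¹ = 300 * N ^ 2 / ρ := by
    rw [mul_pow] at hsq
    have : t ^ 2 = ρ / 300 / N ^ 2 := by
      rw [eq_div_iff (by positivity)]; exact hsq
    rw [this]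
    field_simp
  have h7 := mul_le_mul_of_nonneg_left hvar (by positivity : 0 ≤ (t ^ 2)⁻¹)
  rw [h6] at h7 ⊢
  have h8 : 300 * N ^ 2 / ρ * (2 * (Real.exp 1 - 1)) ≤ 1100 / ρ * N ^ 2 := by
    rw [div_mul_eq_mul_div, div_mul_eq_mul_div]
    refine div_le_div_of_nonneg_right ?_ hρ'.le
    nlinarith [sq_nonneg N]
  linarith

/-! ### Tail bounds through a composition -/

/-- The indicator of the event that `F` differs from `1` by more than `ε`. -/
noncomputable def badInd (ε F : ℝ) : ℝ := if |F - 1| ≤ ε then 0 else 1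

theorem badInd_le_one (ε F : ℝ) : badInd ε F ≤ 1 := by
  unfold badInd; split_ifs <;> norm_num

/-- The bound for the probability that a squared norm, starting from `N`, ends up far from `1`. -/
noncomputable def tailBound (l ε a N : ℝ) : ℝ :=
  Real.exp (-(l - 600 * l ^ 2 * a) * N + l * (1 - ε)) +
    Real.exp ((l + 2400 * l ^ 2 * a) * N - l * (1 + ε))

/-- Exponential Markov inequality on both sides, before any expectation is taken; `a = 0` means that
no random factor has been integrated out. -/
theorem badInd_le_tailBound {l ε F : ℝ} (hl : 0 ≤ l) : badInd ε F ≤ tailBound l ε 0 F := by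
  unfold badInd tailBound
  split_ifs with h
  · positivity
  · rw [abs_le, not_and_or, not_le, not_le] at h
    have h1 := Real.exp_pos (-(l - 600 * l ^ 2 * 0) * F + l * (1 - ε))
    have h2 := Real.exp_pos ((l + 2400 * l ^ 2 * 0) * F - l * (1 + ε))
    rcases h with h | h
    · have : 1 ≤ Real.exp (-(l - 600 * l ^ 2 * 0) * F + l * (1 - ε)) := by
        apply Real.one_le_exp
        nlinarith
      linarith
    · have : 1 ≤ Real.exp ((l + 2400 * l ^ 2 * 0) * F - l * (1 + ε)) := by
        apply Real.one_le_exp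
        nlinarith
      linarith

/-- Integrating out one factor with `ρ` rows keeps the shape of the bound and only adds `1 / ρ` to
`a`. If `N ≤ 2`, the quadratic term of the moment generating function becomes linear through `N² ≤ 2
* N`. The parameters `μ ≤ l` and `ν ≤ 2 * l` then give the constants `600 = 300 * 2` and `2400 = 300
* 4 * 2`. If `N > 2`, the second exponential is already at least `1`, and the trivial bound for an
indicator suffices. -/
theorem expect_le_tailBound {Ω : Type*} [Fintype Ω] [Nonempty Ω] {F b : Ω → ℝ} {N ρ a l ε : ℝ}
    (hb1 : ∀ ω, b ω ≤ 1) (hb : ∀ ω, b ω ≤ tailBound l ε a (F ω)) (hN : 0 ≤ N) (hρ : 0 < ρ)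
    (ha : 0 ≤ a) (hl : 0 ≤ l) (hε : ε ≤ 1) (hla : 2400 * l * (a + 1 / ρ) ≤ 1)
    (hexp : ∀ t : ℝ, |t| * N ≤ ρ / 8 →
      𝔼 ω, Real.exp (t * F ω) ≤ Real.exp (t * N + 300 * (t * N) ^ 2 / ρ)) :
    𝔼 ω, b ω ≤ tailBound l ε (a + 1 / ρ) N := by
  have hρ1 : 0 < 1 / ρ := by positivity
  have hlρ : 2400 * l ≤ ρ := by
    have h1 : 2400 * l * (1 / ρ) ≤ 1 := by nlinarith
    rwa [mul_one_div, div_le_one hρ] at h1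
  have hla' : 2400 * l * a ≤ 1 := by nlinarith
  have hl2a : 2400 * l ^ 2 * a ≤ l := by nlinarith
  have hl2a0 : 0 ≤ l ^ 2 * a := by positivity
  by_cases h2 : N ≤ 2
  · set μ := l - 600 * l ^ 2 * a with hμ
    set ν := l + 2400 * l ^ 2 * a with hν
    have hμ0 : 0 ≤ μ := by linarith
    have hμl : μ ≤ l := by linarith
    have hν0 : 0 ≤ ν := by linarith
    have hνl : ν ≤ 2 * l := by linarith
    have e1 := hexp (-μ) (by rw [abs_neg, abs_of_nonneg hμ0]; nlinarith)
    have e2 := hexp ν (by rw [abs_of_nonneg hν0]; nlinarith)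
    have h3 : 𝔼 ω, b ω ≤ 𝔼 ω, (Real.exp (l * (1 - ε)) * Real.exp (-μ * F ω) +
        Real.exp (-(l * (1 + ε))) * Real.exp (ν * F ω)) := by
      refine Finset.expect_le_expect fun ω _ => (hb ω).trans (le_of_eq ?_)
      rw [tailBound, ← Real.exp_add, ← Real.exp_add]
      congr 2 <;> ring
    rw [Finset.expect_add_distrib, ← Finset.mul_expect, ← Finset.mul_expect] at h3
    refine h3.trans (add_le_add ?_ ?_)
    · refine (mul_le_mul_of_nonneg_left e1 (Real.exp_pos _).le).trans ?_
      rw [← Real.exp_add, Real.exp_le_exp]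
      have h4 : 300 * (-μ * N) ^ 2 / ρ ≤ 600 * l ^ 2 * (1 / ρ) * N := by
        rw [mul_one_div, div_mul_eq_mul_div]
        refine div_le_div_of_nonneg_right ?_ hρ.le
        have h5 : μ ^ 2 ≤ l ^ 2 := pow_le_pow_left₀ hμ0 hμl 2
        have h6 : N ^ 2 ≤ 2 * N := by nlinarith
        have h7 : μ ^ 2 * N ^ 2 ≤ l ^ 2 * (2 * N) := mul_le_mul h5 h6 (sq_nonneg N) (sq_nonneg l)
        nlinarith
      rw [hμ] at h4 ⊢
      linarith
    · refine (mul_le_mul_of_nonneg_left e2 (Real.exp_pos _).le).trans ?_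
      rw [← Real.exp_add, Real.exp_le_exp]
      have h4 : 300 * (ν * N) ^ 2 / ρ ≤ 2400 * l ^ 2 * (1 / ρ) * N := by
        rw [mul_one_div, div_mul_eq_mul_div]
        refine div_le_div_of_nonneg_right ?_ hρ.le
        have h5 : ν ^ 2 ≤ (2 * l) ^ 2 := pow_le_pow_left₀ hν0 hνl 2
        have h6 : N ^ 2 ≤ 2 * N := by nlinarith
        have h7 : ν ^ 2 * N ^ 2 ≤ (2 * l) ^ 2 * (2 * N) :=
          mul_le_mul h5 h6 (sq_nonneg N) (sq_nonneg _)
        nlinarith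
      rw [hν] at h4 ⊢
      linarith
  · push Not at h2
    have h3 : 𝔼 ω, b ω ≤ 1 := by
      calc 𝔼 ω, b ω ≤ 𝔼 _ω : Ω, (1 : ℝ) := Finset.expect_le_expect fun ω _ => hb1 ω
        _ = 1 := Fintype.expect_const 1
    refine h3.trans ?_
    unfold tailBound
    have h4 : 1 ≤ Real.exp ((l + 2400 * l ^ 2 * (a + 1 / ρ)) * N - l * (1 + ε)) := by
      apply Real.one_le_exp
      have h5 : 0 ≤ 2400 * l ^ 2 * (a + 1 / ρ) := by positivity
      nlinarith
    linarith [Real.exp_pos (-(l - 600 * l ^ 2 * (a + 1 / ρ)) * N + l * (1 - ε))]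

/-- The matrix with the right half of the columns below the left half. -/
def fold (p j : ℕ) (Y : ℕ → ℕ → ℝ) (t c : ℕ) : ℝ := Y (t % p) (c + t / p * 2 ^ j)

theorem frobSq_fold (p j : ℕ) (Y : ℕ → ℕ → ℝ) :
    frobSq (2 * p) (2 ^ j) (fold p j Y) = frobSq p (2 ^ (j + 1)) Y := by
  unfold frobSq
  rw [sum_range_mul, pow_succ, Nat.mul_comm (2 ^ j) 2]
  simp only [sum_range_mul 2 (2 ^ j)]
  rw [Finset.sum_comm' (t' := Finset.range p) (s' := fun _ => Finset.range 2) (by simp)]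
  refine Finset.sum_congr rfl fun h hh => Finset.sum_congr rfl fun g _ => Finset.sum_congr rfl
    fun c _ => ?_
  have hh := Finset.mem_range.1 hh
  have e1 : (g * p + h) % p = h := by rw [Nat.mul_comm, Nat.mul_add_mod, Nat.mod_eq_of_lt hh]
  have e2 : (g * p + h) / p = g := by
    rw [Nat.mul_comm, Nat.mul_add_div (by omega), Nat.div_eq_of_lt hh, Nat.add_zero]
  rw [fold, e1, e2, Nat.add_comm]

theorem signMul_fold {r p : ℕ} (ξ : Fin r → Fin (2 * p) → Bool) (j : ℕ) (Y : ℕ → ℕ → ℝ) (i c : ℕ) :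
    ∑ g ∈ Finset.range 2, ∑ h ∈ Finset.range p, signMat ξ i (g * p + h) * Y h (c + g * 2 ^ j) =
      signMul ξ (fold p j Y) i c := by
  rw [signMul, sum_range_mul]
  refine Finset.sum_congr rfl fun g _ => Finset.sum_congr rfl fun h hh => ?_
  have hh := Finset.mem_range.1 hh
  have e1 : (g * p + h) % p = h := by rw [Nat.mul_comm, Nat.mul_add_mod, Nat.mod_eq_of_lt hh]
  have e2 : (g * p + h) / p = g := by
    rw [Nat.mul_comm, Nat.mul_add_div (by omega), Nat.div_eq_of_lt hh, Nat.add_zero]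
  rw [fold, e1, e2]

/-- The squared norm of the first `k` entries. -/
def normSq (k : ℕ) (y : ℕ → ℝ) : ℝ := ∑ i ∈ Finset.range k, y i ^ 2

/-- Induction on the number of halvings, the probability space being chosen before `Y`.
Conditionally on the outermost sign matrix, the remaining chain acts on a fixed matrix, so the
induction hypothesis applies and its bound is then averaged. Second moments multiply, while the tail
parameters `1 / r` add. -/
theorem exists_random_chain {k r : ℕ} (hk : 0 < k) (hr : 0 < r) (j : ℕ) :
    ∀ p : ℕ, ∃ (Ω : Type) (_ : Fintype Ω) (_ : Nonempty Ω) (Af : Ω → ℕ → ℕ → ℝ)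
      (A : Ω → ℕ → ℕ → ℕ → ℝ), ∀ Y : ℕ → ℕ → ℝ,
      𝔼 ω, normSq k (chain r (Af ω) (A ω) j p Y) = frobSq p (2 ^ j) Y ∧
      𝔼 ω, normSq k (chain r (Af ω) (A ω) j p Y) ^ 2 ≤
        (1 + 1100 / (k : ℝ)) * (1 + 1100 / (r : ℝ)) ^ j * frobSq p (2 ^ j) Y ^ 2 ∧
      ∀ l ε : ℝ, 0 ≤ l → ε ≤ 1 → 2400 * l * (1 / k + j / r) ≤ 1 →
        𝔼 ω, badInd ε (normSq k (chain r (Af ω) (A ω) j p Y)) ≤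
          tailBound l ε (1 / k + j / r) (frobSq p (2 ^ j) Y) := by
  have hk' : (0 : ℝ) < k := by exact_mod_cast hk
  have hr' : (0 : ℝ) < r := by exact_mod_cast hr
  induction j with
  | zero =>
    intro p
    refine ⟨Fin k → Fin p → Bool, inferInstance, inferInstance, fun ξ => signMat ξ,
      fun _ _ _ _ => 0, fun Y => ?_⟩
    have h1 : ∀ ξ : Fin k → Fin p → Bool,
        normSq k (chain r (signMat ξ) (fun _ _ _ => 0) 0 p Y) = frobSq k 1 (signMul ξ Y) :=
      fun ξ => by simp [normSq, chain, frobSq, signMul]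
    simp only [h1, pow_zero, mul_one]
    refine ⟨expect_frobSq_signMul hk p 1 Y, expect_sq_frobSq_signMul hk p 1 Y,
      fun l ε hl hε hla => ?_⟩
    simp only [Nat.cast_zero, zero_div, add_zero] at hla ⊢
    rw [← zero_add (1 / (k : ℝ))] at hla ⊢
    exact expect_le_tailBound (fun _ => badInd_le_one _ _) (fun _ => badInd_le_tailBound hl)
      (frobSq_nonneg _ _ _) hk' le_rfl hl hε hla fun t ht => expect_exp_frobSq_signMul hk p 1 Y ht
  | succ j ih =>
    intro p
    obtain ⟨Ω, _, _, Af, A, h⟩ := ih r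
    refine ⟨(Fin r → Fin (2 * p) → Bool) × Ω, inferInstance, inferInstance, fun ω => Af ω.2,
      fun ω i => if i = j then signMat ω.1 else A ω.2 i, fun Y => ?_⟩
    have h1 : ∀ (ξ : Fin r → Fin (2 * p) → Bool) (ω : Ω),
        chain r (Af ω) (fun i => if i = j then signMat ξ else A ω i) (j + 1) p Y =
          chain r (Af ω) (A ω) j r (signMul ξ (fold p j Y)) := fun ξ ω => by
      simp only [chain, if_true, signMul_fold]
      exact chain_congr_left r (Af ω) j r _ fun l hl => if_neg (by omega)
    simp only [expect_prod_type, h1]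
    set Y₁ := fold p j Y with hY₁
    have hN : frobSq p (2 ^ (j + 1)) Y = frobSq (2 * p) (2 ^ j) Y₁ := (frobSq_fold p j Y).symm
    rw [hN]
    refine ⟨?_, ?_, fun l ε hl hε hla => ?_⟩
    · simp only [fun ξ : Fin r → Fin (2 * p) → Bool => (h (signMul ξ Y₁)).1]
      exact expect_frobSq_signMul hr _ _ _
    · refine (Finset.expect_le_expect fun ξ _ => (h (signMul ξ Y₁)).2.1).trans ?_
      rw [← Finset.mul_expect]
      refine (mul_le_mul_of_nonneg_left (expect_sq_frobSq_signMul hr _ _ _) (by positivity)).trans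
        (le_of_eq ?_)
      rw [pow_succ]
      ring
    · have h2 : 1 / (k : ℝ) + ((j + 1 : ℕ) : ℝ) / r = 1 / k + j / r + 1 / r := by
        push_cast; ring
      rw [h2] at hla ⊢
      have hla' : 2400 * l * (1 / (k : ℝ) + j / r) ≤ 1 := by
        have : 0 ≤ 2400 * l * (1 / (r : ℝ)) := by positivity
        linarith
      refine expect_le_tailBound (F := fun ξ : Fin r → Fin (2 * p) → Bool =>
        frobSq r (2 ^ j) (signMul ξ Y₁)) (fun ξ => ?_)
        (fun ξ => (h (signMul ξ Y₁)).2.2 l ε hl hε hla')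
        (frobSq_nonneg _ _ _) hr' (by positivity) hl hε hla
        fun t ht => expect_exp_frobSq_signMul hr _ _ _ ht
      calc _ ≤ 𝔼 _ω : Ω, (1 : ℝ) := Finset.expect_le_expect fun ω _ => badInd_le_one _ _
        _ = 1 := Fintype.expect_const 1

theorem frobSq_view {d : ℕ} (S : ℕ) (x : Fin d → ℝ) :
    frobSq (d / 2 ^ S + 1) (2 ^ S) (view S x) = ∑ i, x i ^ 2 := by
  have h2 : d < (d / 2 ^ S + 1) * 2 ^ S := lt_div_succ_mul (by positivity)
  have h1 : frobSq (d / 2 ^ S + 1) (2 ^ S) (view S x) =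
      ∑ n ∈ Finset.range ((d / 2 ^ S + 1) * 2 ^ S), (if hd : n < d then x ⟨n, hd⟩ else 0) ^ 2 := by
    rw [sum_range_mul]; rfl
  rw [h1, ← Nat.add_sub_of_le h2.le, Finset.sum_range_add, Finset.sum_range]
  simp

/-- With `r = k * (S + 1)` the `S` halvings together contribute at most `1 / k` to the tail
parameter, no more than either of the two factors with `k` rows. For the same reason the second
moment stays bounded, by three factors `exp 1100`. -/
theorem exists_random_sketch {k : ℕ} (hk : 0 < k) (d S : ℕ) :
    ∃ (Ω : Type) (_ : Fintype Ω) (_ : Nonempty Ω) (A₀ Af : Ω → ℕ → ℕ → ℝ)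
      (A : Ω → ℕ → ℕ → ℕ → ℝ), ∀ x : Fin d → ℝ, ∑ i, x i ^ 2 = 1 →
      𝔼 ω, normSq k (sketch k (k * (S + 1)) S (A₀ ω) (Af ω) (A ω) x) = 1 ∧
      𝔼 ω, normSq k (sketch k (k * (S + 1)) S (A₀ ω) (Af ω) (A ω) x) ^ 2 ≤ Real.exp 3300 ∧
      ∀ ε : ℝ, 0 ≤ ε → ε ≤ 1 →
        𝔼 ω, badInd ε (normSq k (sketch k (k * (S + 1)) S (A₀ ω) (Af ω) (A ω) x)) ≤
          2 * Real.exp (-(ε ^ 2 * k / 28800)) := by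
  set r := k * (S + 1) with hr
  have hr0 : 0 < r := by positivity
  have hk' : (0 : ℝ) < k := by exact_mod_cast hk
  have hk1 : (1 : ℝ) ≤ k := by exact_mod_cast hk
  have hr' : (0 : ℝ) < r := by exact_mod_cast hr0
  have hSr : (S : ℝ) / r ≤ 1 / k := by
    rw [div_le_div_iff₀ hr' hk', hr]
    push_cast
    nlinarith
  obtain ⟨Ω, _, _, Af, A, h⟩ := exists_random_chain (r := r) hk hr0 S k
  refine ⟨(Fin k → Fin (d / 2 ^ S + 1) → Bool) × Ω, inferInstance, inferInstance,
    fun ω => signMat ω.1, fun ω => Af ω.2, fun ω => A ω.2, fun x hx => ?_⟩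
  have h1 : ∀ (ξ : Fin k → Fin (d / 2 ^ S + 1) → Bool) (ω : Ω),
      sketch k r S (signMat ξ) (Af ω) (A ω) x = chain r (Af ω) (A ω) S k (signMul ξ (view S x)) :=
    fun ξ ω => rfl
  have hN : frobSq (d / 2 ^ S + 1) (2 ^ S) (view S x) = 1 := by rw [frobSq_view, hx]
  simp only [expect_prod_type, h1]
  refine ⟨?_, ?_, fun ε hε0 hε => ?_⟩
  · simp only [fun ξ : Fin k → Fin (d / 2 ^ S + 1) → Bool => (h (signMul ξ (view S x))).1]
    rw [expect_frobSq_signMul hk, hN]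
  · refine (Finset.expect_le_expect fun ξ _ => (h (signMul ξ (view S x))).2.1).trans ?_
    rw [← Finset.mul_expect]
    refine (mul_le_mul_of_nonneg_left (expect_sq_frobSq_signMul hk _ _ _) (by positivity)).trans ?_
    rw [hN, one_pow, mul_one]
    have h2 : 1 + 1100 / (k : ℝ) ≤ Real.exp 1100 := by
      have : 1100 / (k : ℝ) ≤ 1100 := div_le_self (by norm_num) hk1
      linarith [Real.add_one_le_exp (1100 : ℝ)]
    have h3 : (1 + 1100 / (r : ℝ)) ^ S ≤ Real.exp 1100 := by
      have h4 : 1 + 1100 / (r : ℝ) ≤ Real.exp (1100 / r) := by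
        linarith [Real.add_one_le_exp (1100 / (r : ℝ))]
      refine (pow_le_pow_left₀ (by positivity) h4 S).trans ?_
      rw [← Real.exp_nat_mul, Real.exp_le_exp]
      have : (S : ℝ) / r ≤ 1 := hSr.trans ((div_le_one hk').2 hk1)
      rw [mul_div_left_comm]
      linarith
    rw [show (3300 : ℝ) = 1100 + 1100 + 1100 by norm_num, Real.exp_add, Real.exp_add]
    gcongr
  -- Chosen so that, with total parameter `a ≤ 3 / k`, the correction `2400 * l² * a` is at most
  -- half of the gain `l * ε`; both exponents are then at most `-l * ε / 2`.
  · set l := ε * k / 14400 with hl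
    have hl0 : 0 ≤ l := by positivity
    have ha : 1 / (k : ℝ) + S / r + 1 / k ≤ 3 / k := by
      have : (3 : ℝ) / k = 1 / k + 1 / k + 1 / k := by ring
      linarith
    have ha0 : 0 ≤ 1 / (k : ℝ) + S / r := by positivity
    have hlk : l * (3 / k) = ε / 4800 := by rw [hl]; field_simp; ring
    have hla : 2400 * l * (1 / (k : ℝ) + S / r + 1 / k) ≤ 1 := by
      have := mul_le_mul_of_nonneg_left ha hl0
      linarith
    have hla' : 2400 * l * (1 / (k : ℝ) + S / r) ≤ 1 := by
      have : 0 ≤ 2400 * l * (1 / (k : ℝ)) := by positivity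
      linarith
    have h2 := expect_le_tailBound (F := fun ξ : Fin k → Fin (d / 2 ^ S + 1) → Bool =>
      frobSq k (2 ^ S) (signMul ξ (view S x)))
      (b := fun ξ => 𝔼 ω, badInd ε (normSq k (chain r (Af ω) (A ω) S k (signMul ξ (view S x)))))
      (fun ξ => by
        calc _ ≤ 𝔼 _ω : Ω, (1 : ℝ) := Finset.expect_le_expect fun ω _ => badInd_le_one _ _
          _ = 1 := Fintype.expect_const 1)
      (fun ξ => (h (signMul ξ (view S x))).2.2 l ε hl0 hε hla')
      (frobSq_nonneg _ _ _) hk' ha0 hl0 hε hla fun t ht => expect_exp_frobSq_signMul hk _ _ _ ht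
    refine h2.trans ?_
    rw [hN, two_mul]
    have h3 : l ^ 2 * (1 / (k : ℝ) + S / r + 1 / k) ≤ l * (ε / 4800) := by
      rw [← hlk]
      nlinarith [mul_le_mul_of_nonneg_left ha (mul_nonneg hl0 hl0)]
    have h4 : ε ^ 2 * k / 28800 = l * (ε / 2) := by rw [hl]; ring
    unfold tailBound
    rw [h4]
    refine add_le_add (Real.exp_le_exp.2 ?_) (Real.exp_le_exp.2 ?_) <;> nlinarith

/-! ### The matrix of the sketch -/

theorem view_add {d : ℕ} (S : ℕ) (x y : Fin d → ℝ) (h c : ℕ) :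
    view S (x + y) h c = view S x h c + view S y h c := by
  unfold view; split_ifs <;> simp

theorem view_smul {d : ℕ} (S : ℕ) (t : ℝ) (x : Fin d → ℝ) (h c : ℕ) :
    view S (t • x) h c = t * view S x h c := by
  unfold view; split_ifs <;> simp

theorem sketch_add (k r S : ℕ) (A₀ Af : ℕ → ℕ → ℝ) (A : ℕ → ℕ → ℕ → ℝ) {d : ℕ}
    (x y : Fin d → ℝ) :
    sketch k r S A₀ Af A (x + y) = sketch k r S A₀ Af A x + sketch k r S A₀ Af A y := by
  simp only [sketch, view_add, ← chain_add, mul_add, Finset.sum_add_distrib]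

theorem sketch_smul (k r S : ℕ) (A₀ Af : ℕ → ℕ → ℝ) (A : ℕ → ℕ → ℕ → ℝ) {d : ℕ} (t : ℝ)
    (x : Fin d → ℝ) : sketch k r S A₀ Af A (t • x) = t • sketch k r S A₀ Af A x := by
  simp only [sketch, view_smul, ← chain_smul, Finset.mul_sum, mul_left_comm]

theorem sketch_smul_left (k r S : ℕ) (A₀ Af : ℕ → ℕ → ℝ) (A : ℕ → ℕ → ℕ → ℝ) {d : ℕ} (t : ℝ)
    (x : Fin d → ℝ) : sketch k r S (t • A₀) Af A x = t • sketch k r S A₀ Af A x := by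
  simp only [sketch, ← chain_smul, Finset.mul_sum, Pi.smul_apply, smul_eq_mul, mul_assoc]

/-- The matrix of the linear map `sketch`. -/
noncomputable def sketchMatrix (d k r S : ℕ) (A₀ Af : ℕ → ℕ → ℝ) (A : ℕ → ℕ → ℕ → ℝ) :
    Matrix (Fin k) (Fin d) ℝ :=
  LinearMap.toMatrix'
    { toFun := fun x i => sketch k r S A₀ Af A x i
      map_add' := fun x y => by funext i; simp [sketch_add]
      map_smul' := fun t x => by funext i; simp [sketch_smul] }

theorem sketchMatrix_mulVec (d k r S : ℕ) (A₀ Af : ℕ → ℕ → ℝ) (A : ℕ → ℕ → ℕ → ℝ)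
    (x : Fin d → ℝ) (i : Fin k) :
    (sketchMatrix d k r S A₀ Af A *ᵥ x) i = sketch k r S A₀ Af A x i := by
  rw [sketchMatrix, LinearMap.toMatrix'_mulVec]; rfl

theorem norm_sketchMatrix_mulVec (d k r S : ℕ) (A₀ Af : ℕ → ℕ → ℝ) (A : ℕ → ℕ → ℕ → ℝ)
    (x : Fin d → ℝ) :
    ‖WithLp.toLp 2 (sketchMatrix d k r S A₀ Af A *ᵥ x)‖ =
      √(normSq k (sketch k r S A₀ Af A x)) := by
  rw [EuclideanSpace.norm_eq, normSq, Finset.sum_range]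
  simp only [Real.norm_eq_abs, sq_abs, sketchMatrix_mulVec]

theorem normSq_nonneg (k : ℕ) (y : ℕ → ℝ) : 0 ≤ normSq k y :=
  Finset.sum_nonneg fun _ _ => sq_nonneg _

theorem normSq_smul (k : ℕ) (t : ℝ) (y : ℕ → ℝ) : normSq k (t • y) = t ^ 2 * normSq k y := by
  simp only [normSq, Finset.mul_sum, Pi.smul_apply, smul_eq_mul, mul_pow]

/-! ### Failure probability close to one -/

/-- The indicator of the event that `√F` differs from `1` by at most `ε`. -/
noncomputable def goodInd (ε F : ℝ) : ℝ := if |√F - 1| ≤ ε then 1 else 0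

theorem goodInd_nonneg (ε F : ℝ) : 0 ≤ goodInd ε F := by
  unfold goodInd; split_ifs <;> norm_num

theorem one_sub_badInd_le_goodInd {ε F : ℝ} (hF : 0 ≤ F) : 1 - badInd ε F ≤ goodInd ε F := by
  unfold badInd goodInd
  have h : |√F - 1| ≤ |F - 1| := by
    have h1 : F - 1 = (√F - 1) * (√F + 1) := by
      have := Real.sq_sqrt hF
      linear_combination -this
    have h2 : 0 ≤ √F := Real.sqrt_nonneg F
    rw [h1, abs_mul, abs_of_nonneg (by linarith : 0 ≤ √F + 1)]
    exact le_mul_of_one_le_right (abs_nonneg _) (by linarith)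
  by_cases hε : |F - 1| ≤ ε
  · rw [if_pos hε, if_pos (h.trans hε)]; norm_num
  · rw [if_neg hε]; split_ifs <;> norm_num

/-- The indicator of the event that `F` is within a factor `exp η` of `1`. -/
noncomputable def windowInd (η F : ℝ) : ℝ := if 0 < F ∧ |Real.log F| ≤ η then 1 else 0

theorem one_sub_badInd_le_windowInd {ε F : ℝ} (hε0 : 0 ≤ ε) (hε : ε ≤ 1 / 2) :
    1 - badInd ε F ≤ windowInd (2 * ε) F := by
  unfold badInd windowInd
  by_cases h : |F - 1| ≤ ε
  · have h' := abs_le.1 h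
    have hF : 1 / 2 ≤ F := by linarith
    have hF0 : 0 < F := by linarith
    rw [if_pos h, if_pos]
    · norm_num
    · refine ⟨hF0, abs_le.2 ⟨?_, ?_⟩⟩
      · have h1 := Real.one_sub_inv_le_log_of_pos hF0
        have h2 : 1 - F⁻¹ = (F - 1) / F := by field_simp
        have h3 : -(2 * ε) ≤ (F - 1) / F := by
          rw [le_div_iff₀ hF0]; nlinarith
        linarith
      · have := Real.log_le_sub_one_of_pos hF0
        linarith
  · rw [if_neg h]; split_ifs <;> norm_num

/-- This is a Paley–Zygmund argument in pointwise form: after taking expectations, a mean of `1` and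
a bounded second moment force positive mass between `1 / 2` and `B`. -/
theorem le_windowInd {B F : ℝ} (hB : 2 ≤ B) (hF : 0 ≤ F) :
    F ≤ 1 / 2 + B * windowInd (Real.log B) F + F ^ 2 / B := by
  have hB0 : 0 < B := by linarith
  have h2 : 0 ≤ F ^ 2 / B := by positivity
  have hw : 0 ≤ windowInd (Real.log B) F := by unfold windowInd; split_ifs <;> norm_num
  have hBw := mul_nonneg hB0.le hw
  rcases le_total F (1 / 2) with h | h
  · linarith
  rcases le_total F B with h' | h'
  · have hF0 : 0 < F := by linarith
    have : windowInd (Real.log B) F = 1 := by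
      refine if_pos ⟨hF0, abs_le.2 ⟨?_, Real.log_le_log hF0 h'⟩⟩
      rw [← Real.log_inv]
      refine Real.log_le_log (by positivity) (le_trans ?_ h)
      rw [one_div]
      exact inv_anti₀ (by norm_num) hB
    rw [this]; linarith
  · have : F ≤ F ^ 2 / B := by rw [le_div_iff₀ hB0]; nlinarith
    linarith

theorem windowInd_mono {η η' : ℝ} (h : η ≤ η') (F : ℝ) : windowInd η F ≤ windowInd η' F := by
  unfold windowInd
  by_cases h1 : 0 < F ∧ |Real.log F| ≤ η
  · rw [if_pos h1, if_pos ⟨h1.1, h1.2.trans h⟩]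
  · rw [if_neg h1]; split_ifs <;> norm_num

/-- A squared norm with the moments and tails of a sketch is in a window of width `O(1 / √k)` with
constant probability. -/
theorem exists_window : ∃ p c : ℝ, 0 < p ∧ 0 < c ∧ ∀ (k : ℕ), 0 < k →
    ∀ (Ω : Type) [Fintype Ω] [Nonempty Ω] (F : Ω → ℝ), (∀ ω, 0 ≤ F ω) → 𝔼 ω, F ω = 1 →
      𝔼 ω, F ω ^ 2 ≤ Real.exp 3300 →
      (∀ ε : ℝ, 0 ≤ ε → ε ≤ 1 →
        𝔼 ω, badInd ε (F ω) ≤ 2 * Real.exp (-(ε ^ 2 * k / 28800))) →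
      p ≤ 𝔼 ω, windowInd (c / √k) (F ω) := by
  set E := Real.exp 3300 with hE
  have hE1 : 1 ≤ E := Real.one_le_exp (by norm_num)
  set B := 4 * E with hB
  have hB1 : 4 ≤ B := by linarith
  have hη : 1 ≤ Real.log B := by
    rw [hB, Real.log_mul (by norm_num) (by positivity), hE, Real.log_exp]
    have : 0 ≤ Real.log 4 := Real.log_nonneg (by norm_num)
    linarith
  -- For `√k ≥ 480` the tail bound gives mass at least `1 / 2` in the window. For smaller `k` a
  -- window of logarithmic width `log B` is enough, with mass at least `1 / (4 * B)` by
  -- `le_windowInd`. The width constant `480 * log B` covers both cases.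
  refine ⟨1 / (4 * B), 480 * Real.log B, by positivity, by positivity, ?_⟩
  intro k hk Ω _ _ F hF h1 h2 hbad
  have hp : 1 / (4 * B) ≤ 1 / 2 := by
    apply one_div_le_one_div_of_le <;> linarith
  have hk0 : 0 < √(k : ℝ) := Real.sqrt_pos.2 (by exact_mod_cast hk)
  have hsq : √(k : ℝ) ^ 2 = k := Real.sq_sqrt (by positivity)
  rcases le_total 480 (√(k : ℝ)) with h | h
  -- Then `ε² * k / 28800 = 2`, and `2 * exp (-2) ≤ 1 / 2`.
  · set ε := 240 / √(k : ℝ) with hε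
    have hε0 : 0 ≤ ε := by positivity
    have hε1 : ε ≤ 1 / 2 := by rw [hε, div_le_iff₀ hk0]; linarith
    have hb := hbad ε hε0 (by linarith)
    have he : ε ^ 2 * k / 28800 = 2 := by
      rw [← hsq, hε]; field_simp; norm_num
    rw [he] at hb
    have he2 : Real.exp (-2) ≤ 1 / 4 := by
      rw [Real.exp_neg, one_div]
      refine inv_anti₀ (by norm_num) ?_
      have := Real.add_one_le_exp (1 : ℝ)
      rw [show (2 : ℝ) = 1 + 1 by norm_num, Real.exp_add]
      nlinarith
    have h3 : 𝔼 ω, (1 - badInd ε (F ω)) ≤ 𝔼 ω, windowInd (480 * Real.log B / √k) (F ω) := by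
      refine Finset.expect_le_expect fun ω _ => (one_sub_badInd_le_windowInd hε0 hε1).trans
        (windowInd_mono ?_ _)
      rw [hε, mul_div_assoc']
      exact div_le_div_of_nonneg_right (by linarith) hk0.le
    rw [Finset.expect_sub_distrib, Fintype.expect_const] at h3
    linarith
  · have h3 : 𝔼 ω, F ω ≤ 𝔼 ω, (1 / 2 + B * windowInd (480 * Real.log B / √k) (F ω) +
        F ω ^ 2 / B) := by
      refine Finset.expect_le_expect fun ω _ => (le_windowInd (B := B) (by linarith) (hF ω)).trans ?_
      have : windowInd (Real.log B) (F ω) ≤ windowInd (480 * Real.log B / √k) (F ω) := by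
        refine windowInd_mono ?_ _
        rw [le_div_iff₀ hk0, mul_comm]
        gcongr
      have := mul_le_mul_of_nonneg_left this (by linarith : 0 ≤ B)
      linarith
    simp only [Finset.expect_add_distrib, Fintype.expect_const, ← Finset.mul_expect,
      ← Finset.expect_div] at h3
    rw [h1] at h3
    have h4 : (𝔼 ω, F ω ^ 2) / B ≤ 1 / 4 := by
      rw [div_le_iff₀ (by linarith)]; linarith
    rw [div_le_iff₀ (by linarith)]
    nlinarith

/-- Rounding `-log F` down to a multiple of `ε` puts the logarithm of the scaled squared norm in
`(-ε, 0]`, hence the norm in `(1 - ε / 2, 1]`. -/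
theorem goodInd_exp_mul {ε F : ℝ} (hε : 0 < ε) {m : ℕ} (hF : 0 < F) (h : |Real.log F| ≤ m * ε) :
    ∃ j : Fin (2 * m + 1), goodInd ε (Real.exp (((j : ℝ) - m) * ε) * F) = 1 := by
  set n := ⌊-Real.log F / ε⌋ with hn
  have h' := abs_le.1 h
  have h1 : -(m : ℤ) ≤ n := by
    rw [hn, Int.le_floor, le_div_iff₀ hε]; push_cast; linarith
  have h2 : n ≤ m := by
    have : (n : ℝ) ≤ m := (Int.floor_le _).trans (by rw [div_le_iff₀ hε]; linarith)
    exact_mod_cast this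
  refine ⟨⟨(n + m).toNat, by omega⟩, ?_⟩
  have h3 : (((n + m).toNat : ℕ) : ℝ) - m = n := by
    have : (((n + m).toNat : ℕ) : ℤ) = n + m := Int.toNat_of_nonneg (by omega)
    have : (((n + m).toNat : ℕ) : ℝ) = n + m := by exact_mod_cast this
    rw [this]; ring
  simp only [h3]
  have h4 : (n : ℝ) * ε ≤ -Real.log F := by
    rw [← le_div_iff₀ hε]; exact Int.floor_le _
  have h5 : -Real.log F < (n + 1) * ε := by
    rw [← div_lt_iff₀ hε]; exact Int.lt_floor_add_one _
  have h6 : √(Real.exp (n * ε) * F) = Real.exp ((n * ε + Real.log F) / 2) := by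
    rw [Real.exp_half, Real.exp_add, Real.exp_log hF]
  unfold goodInd
  rw [if_pos]
  rw [h6, abs_le]
  have h7 := Real.add_one_le_exp ((n * ε + Real.log F) / 2)
  have h8 : Real.exp ((n * ε + Real.log F) / 2) ≤ 1 := Real.exp_le_one_iff.2 (by linarith)
  constructor <;> linarith

theorem windowInd_le_expect {ε F : ℝ} (hε : 0 < ε) (m : ℕ) :
    windowInd (m * ε) F ≤
      (2 * m + 1) * 𝔼 j : Fin (2 * m + 1), goodInd ε (Real.exp (((j : ℝ) - m) * ε) * F) := by
  have h0 : (2 * (m : ℝ) + 1) * 𝔼 j : Fin (2 * m + 1),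
      goodInd ε (Real.exp (((j : ℝ) - m) * ε) * F) =
      ∑ j : Fin (2 * m + 1), goodInd ε (Real.exp (((j : ℝ) - m) * ε) * F) := by
    rw [Fintype.expect_eq_sum_div_card, Fintype.card_fin]
    push_cast
    exact mul_div_cancel₀ _ (by positivity)
  rw [h0]
  have h1 : ∀ j ∈ (Finset.univ : Finset (Fin (2 * m + 1))),
      0 ≤ goodInd ε (Real.exp (((j : ℝ) - m) * ε) * F) := fun j _ => goodInd_nonneg _ _
  unfold windowInd
  split_ifs with h
  · obtain ⟨j, hj⟩ := goodInd_exp_mul hε h.1 h.2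
    rw [← hj]
    exact Finset.single_le_sum h1 (Finset.mem_univ j)
  · exact Finset.sum_nonneg h1

/-- Randomly scaled sketches are Johnson-Lindenstrauss with failure probability close to `1`, if the
squared norm is in a window of width `m * ε` with probability at least `p`. -/
theorem le_expect_goodInd {Ω : Type} [Fintype Ω] [Nonempty Ω] (F : Ω → ℝ) {ε p : ℝ} (hε : 0 < ε)
    (m : ℕ) (h : p ≤ 𝔼 ω, windowInd (m * ε) (F ω)) :
    p / (2 * m + 1) ≤ 𝔼 ω : Ω × Fin (2 * m + 1),
      goodInd ε (Real.exp (((ω.2 : ℝ) - m) * ε) * F ω.1) := by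
  rw [expect_prod_type, div_le_iff₀ (by positivity), mul_comm, Finset.mul_expect]
  exact h.trans (Finset.expect_le_expect fun ω _ => windowInd_le_expect hε m)

theorem exists_johnsonLindenstrauss_sketch : ∃ C : ℝ, 0 < C ∧ ∀ (d k S : ℕ) (ε δ : ℝ), 0 < ε →
    0 < δ → C * ε⁻¹ ^ 2 * Real.log (1 / δ) ≤ k →
    ∃ (Ω : Type) (_ : Fintype Ω) (_ : Nonempty Ω) (A₀ Af : Ω → ℕ → ℕ → ℝ)
      (A : Ω → ℕ → ℕ → ℕ → ℝ), ∀ x : Fin d → ℝ, ∑ i, x i ^ 2 = 1 →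
      1 - δ ≤ 𝔼 ω, goodInd ε (normSq k (sketch k (k * (S + 1)) S (A₀ ω) (Af ω) (A ω) x)) := by
  obtain ⟨p, c, hp, hc, hwin⟩ := exists_window
  -- The first summand makes `log (1 / δ) ≤ ε² * k / 57600`, for the exponential tail. The second
  -- serves the rescaled sketch with `y = ε * √k ≤ 240`: there `1 - δ ≤ y² / C`, `y² ≤ 240 * y`, and
  -- `(2 * m + 1) * y ≤ 2 * c + 3 * y ≤ 2 * c + 720`.
  set C := 57600 + 240 * (2 * c + 720) / p with hC
  have hC0 : 0 < C := by positivity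
  refine ⟨C, hC0, ?_⟩
  intro d k S ε δ hε hδ hk
  by_cases htriv : 1 ≤ ε ∨ 1 ≤ δ
  -- The zero matrix has norm error exactly `1`; the scalar `0` is explicit so that
  -- `sketch_smul_left` and `normSq_smul` evaluate the norm.
  · refine ⟨Unit, inferInstance, inferInstance, fun _ => (0 : ℝ) • 0, fun _ => 0, fun _ => 0, ?_⟩
    intro x _
    simp only [sketch_smul_left, normSq_smul, Fintype.expect_const]
    rcases htriv with h | h
    · rw [goodInd, if_pos (by simpa using h)]; linarith
    · exact (by linarith : 1 - δ ≤ 0).trans (goodInd_nonneg _ _)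
  push Not at htriv
  obtain ⟨hε1, hδ1⟩ := htriv
  have hlog : 1 - δ ≤ Real.log (1 / δ) := by
    rw [one_div, Real.log_inv]
    have := Real.log_le_sub_one_of_pos hδ
    linarith
  have hlog0 : 0 < Real.log (1 / δ) := by linarith
  have hk0 : 0 < (k : ℝ) := lt_of_lt_of_le (by positivity) hk
  have hk' : 0 < k := by exact_mod_cast hk0
  have hlog1 : C * Real.log (1 / δ) ≤ ε ^ 2 * k := by
    have := mul_le_mul_of_nonneg_left hk (sq_nonneg ε)
    have e : ε ^ 2 * (C * ε⁻¹ ^ 2 * Real.log (1 / δ)) = C * Real.log (1 / δ) := by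
      field_simp
    linarith
  obtain ⟨Ω, _, _, A₀, Af, A, hΩ⟩ := exists_random_sketch hk' d S
  rcases le_total 57600 (ε ^ 2 * k) with hbig | hsmall
  · refine ⟨Ω, inferInstance, inferInstance, A₀, Af, A, fun x hx => ?_⟩
    have hb := (hΩ x hx).2.2 ε hε.le hε1.le
    have h1 : 𝔼 ω, (1 - badInd ε (normSq k (sketch k (k * (S + 1)) S (A₀ ω) (Af ω) (A ω) x))) ≤
        𝔼 ω, goodInd ε (normSq k (sketch k (k * (S + 1)) S (A₀ ω) (Af ω) (A ω) x)) :=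
      Finset.expect_le_expect fun ω _ => one_sub_badInd_le_goodInd (normSq_nonneg _ _)
    rw [Finset.expect_sub_distrib, Fintype.expect_const] at h1
    set z := ε ^ 2 * k / 57600 with hz
    have hz1 : 1 ≤ z := by rw [hz, le_div_iff₀ (by norm_num)]; linarith
    have hz2 : ε ^ 2 * k / 28800 = z + z := by rw [hz]; ring
    have hzl : Real.log (1 / δ) ≤ z := by
      rw [hz, le_div_iff₀ (by norm_num)]
      have : 0 ≤ 240 * (2 * c + 720) / p := by positivity
      nlinarith
    have hzδ : Real.exp (-z) ≤ δ := by
      rw [← Real.le_log_iff_exp_le hδ]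
      rw [one_div, Real.log_inv] at hzl
      linarith
    have hz3 : Real.exp (-z) ≤ 1 / 2 := by
      rw [Real.exp_neg, one_div]
      refine inv_anti₀ (by norm_num) ?_
      have := Real.add_one_le_exp z
      linarith
    rw [hz2, neg_add, Real.exp_add] at hb
    have := Real.exp_pos (-z)
    nlinarith
  · set m := ⌈c / √(k : ℝ) / ε⌉₊ with hm
    have hs0 : 0 < √(k : ℝ) := Real.sqrt_pos.2 hk0
    have hsq : √(k : ℝ) ^ 2 = k := Real.sq_sqrt hk0.le
    refine ⟨Ω × Fin (2 * m + 1), inferInstance, inferInstance,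
      -- The exponent is halved because the grid is for squared norms. Scaling the first factor
      -- scales the whole sketch at no computational cost.
      fun ω => Real.exp (((ω.2 : ℝ) - m) * ε / 2) • A₀ ω.1, fun ω => Af ω.1, fun ω => A ω.1,
      fun x hx => ?_⟩
    obtain ⟨h1, h2, h3⟩ := hΩ x hx
    have hw := hwin k hk' Ω _ (fun ω => normSq_nonneg _ _) h1 h2 h3
    have hle : c / √(k : ℝ) ≤ m * ε := by
      rw [← div_le_iff₀ hε]; exact Nat.le_ceil _
    have hw' := le_expect_goodInd _ hε m
      (hw.trans (Finset.expect_le_expect fun ω _ => windowInd_mono hle _))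
    have he : ∀ a : ℝ, Real.exp (a / 2) ^ 2 = Real.exp a := fun a => by
      rw [← Real.exp_nat_mul]; congr 1; push_cast; ring
    simp only [sketch_smul_left, normSq_smul, he]
    refine le_trans ?_ hw'
    set y := ε * √(k : ℝ) with hy
    have hy0 : 0 < y := by positivity
    have hy2 : y ^ 2 = ε ^ 2 * k := by rw [hy, mul_pow, hsq]
    have hy1 : y ≤ 240 := by nlinarith
    have hm1 : (m : ℝ) ≤ c / y + 1 := by
      rw [hm, div_div, mul_comm (√(k : ℝ)), ← hy]
      exact (Nat.ceil_lt_add_one (by positivity)).le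
    have hm2 : (2 * (m : ℝ) + 1) * y ≤ 2 * c + 720 := by
      have h4 : (m : ℝ) * y ≤ c + y := by
        calc (m : ℝ) * y ≤ (c / y + 1) * y := by gcongr
          _ = c + y := by field_simp
      linarith
    rw [le_div_iff₀ (by positivity)]
    have h5 : (57600 + 240 * (2 * c + 720) / p) * (1 - δ) ≤ y ^ 2 := by
      rw [hy2]
      exact (mul_le_mul_of_nonneg_left hlog hC0.le).trans hlog1
    have h6 : 240 * (2 * c + 720) * (1 - δ) ≤ p * (240 * y) := by
      have h7 : 240 * (2 * c + 720) / p * (1 - δ) ≤ 240 * y := by nlinarith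
      calc 240 * (2 * c + 720) * (1 - δ) = p * (240 * (2 * c + 720) / p * (1 - δ)) := by
            field_simp
        _ ≤ p * (240 * y) := by gcongr
    have h8 : (2 * (m : ℝ) + 1) * y * (1 - δ) ≤ p * y := by
      have : (2 * (m : ℝ) + 1) * y * (1 - δ) ≤ (2 * c + 720) * (1 - δ) :=
        mul_le_mul_of_nonneg_right hm2 (by linarith)
      linarith
    nlinarith

theorem isJohnsonLindenstrauss_sketchMatrix {Ω : Type} [Fintype Ω] [Nonempty Ω]
    [MeasurableSpace Ω] [DiscreteMeasurableSpace Ω] {d k r S : ℕ} {ε δ : ℝ}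
    {A₀ Af : Ω → ℕ → ℕ → ℝ} {A : Ω → ℕ → ℕ → ℕ → ℝ}
    (h : ∀ x : Fin d → ℝ, ∑ i, x i ^ 2 = 1 →
      1 - δ ≤ 𝔼 ω, goodInd ε (normSq k (sketch k r S (A₀ ω) (Af ω) (A ω) x))) :
    IsJohnsonLindenstrauss (ProbabilityTheory.uniformOn (Set.univ : Set Ω))
      (fun ω => sketchMatrix d k r S (A₀ ω) (Af ω) (A ω)) ε δ := by
  classical
  refine ⟨fun i j => Measurable.of_discrete, fun x hx => ?_⟩
  have hx' : ∑ i, x.ofLp i ^ 2 = 1 := by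
    rw [EuclideanSpace.norm_eq, Real.sqrt_eq_one] at hx
    simpa using hx
  refine (h x.ofLp hx').trans (le_of_eq ?_)
  simp only [norm_sketchMatrix_mulVec]
  rw [MeasureTheory.measureReal_def, ProbabilityTheory.uniformOn_univ,
    ENNReal.toReal_div, MeasureTheory.Measure.count_apply_finite _ (Set.toFinite _),
    Fintype.expect_eq_sum_div_card]
  simp [goodInd]

/-! ### Counting operations -/

theorem cast_div_succ_le (p s : ℕ) : ((p / s + 1 : ℕ) : ℝ) ≤ (p : ℝ) / s + 1 := by
  push_cast
  have := @Nat.cast_div_le ℝ _ _ _ p s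
  linarith

theorem cast_div_blk_succ_le {s : ℕ} (hs : 0 < s) (p : ℕ) :
    ((p / blk s + 1 : ℕ) : ℝ) ≤ 3 * p / s + 1 := by
  refine (cast_div_succ_le _ _).trans ?_
  have hb : (0 : ℝ) < blk s := by exact_mod_cast blk_pos hs
  have hs' : (0 : ℝ) < s := by exact_mod_cast hs
  have h3 : (s : ℝ) ≤ 3 * blk s := by exact_mod_cast le_three_mul_blk s
  have : (p : ℝ) / blk s ≤ 3 * p / s := by
    rw [div_le_div_iff₀ hb hs']
    nlinarith [(Nat.cast_nonneg p : (0 : ℝ) ≤ p)]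
  linarith

theorem productCost_le {s ρ : ℕ} (hs : 0 < s) (hρ : s ≤ ρ) (G p J : ℕ) :
    (productCost s ρ G p J : ℝ) ≤ 4 * (ρ / s) * J * (6 * (G * (p / s)) + 2 * G + 2) := by
  have hs' : (0 : ℝ) < s := by exact_mod_cast hs
  have h1 := cast_div_blk_succ_le hs ρ
  have h2 := cast_div_blk_succ_le hs p
  have h3 : (1 : ℝ) ≤ ρ / s := by
    rw [le_div_iff₀ hs', one_mul]; exact_mod_cast hρ
  have h4 : ((ρ / blk s + 1 : ℕ) : ℝ) ≤ 4 * (ρ / s) := by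
    rw [mul_div_assoc] at h1; linarith
  have h5 : ((2 * (G * (p / blk s + 1)) + 2 : ℕ) : ℝ) ≤ 6 * (G * (p / s)) + 2 * G + 2 := by
    have := mul_le_mul_of_nonneg_left h2 (Nat.cast_nonneg G : (0 : ℝ) ≤ G)
    rw [mul_div_assoc] at this
    push_cast at this ⊢
    linarith
  rw [productCost, Nat.cast_mul, Nat.cast_mul]
  gcongr

/-- A level with `2 ^ j` output columns costs at most `72 * (r / s)² * (2 ^ j / s + 1)`. The first
summands form a geometric series, and the block rounding accumulates to the term linear in `j`. -/
theorem chainCost_le {s k r : ℕ} (hs : 0 < s) (hk : s ≤ k) (hr : k ≤ r) (j : ℕ) :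
    ∀ p ≤ r, (chainCost s k r j p : ℝ) ≤ 72 * (r / s : ℝ) ^ 2 * (2 ^ j / s + j + 1) := by
  have hs' : (0 : ℝ) < s := by exact_mod_cast hs
  have hks : (1 : ℝ) ≤ k / s := by
    rw [le_div_iff₀ hs', one_mul]; exact_mod_cast hk
  have hkr : (k : ℝ) / s ≤ r / s := by gcongr
  set a : ℝ := r / s with ha
  have hpa : ∀ p ≤ r, (p : ℝ) / s ≤ a := fun p hp => by rw [ha]; gcongr
  induction j with
  | zero =>
    intro p hp
    have h1 := productCost_le hs hk 1 p 1
    have h2 := cast_div_succ_le k s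
    have h3 := hpa p hp
    have h4 : (0 : ℝ) ≤ p / s := by positivity
    have h5 : (0 : ℝ) ≤ 2 ^ 0 / s := by positivity
    rw [chainCost, Nat.cast_add, Nat.cast_mul]
    push_cast at h1 h2 ⊢
    have h6 : 4 * ((k : ℝ) / s) * 1 * (6 * (1 * (p / s)) + 2 * 1 + 2) ≤ 4 * a * 1 * (10 * a) := by
      gcongr
      linarith
    have h7 : a ≤ a ^ 2 := by nlinarith
    have h8 : 72 * a ^ 2 * 1 ≤ 72 * a ^ 2 * (2 ^ 0 / s + 0 + 1) := by
      gcongr; linarith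
    nlinarith
  | succ j ih =>
    intro p hp
    have h1 := productCost_le hs (hk.trans hr) 2 p (2 ^ j / s + 1)
    have h2 := cast_div_succ_le (2 ^ j) s
    have h3 := hpa p hp
    have h4 : (0 : ℝ) ≤ p / s := by positivity
    have h5 := ih r le_rfl
    rw [chainCost, Nat.cast_add]
    rw [← ha] at h1
    have h6 : 4 * a * ((2 ^ j / s + 1 : ℕ) : ℝ) * (6 * ((2 : ℕ) * (p / s)) + 2 * (2 : ℕ) + 2) ≤
        4 * a * (2 ^ j / s + 1) * (18 * a) := by
      push_cast at h2 ⊢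
      gcongr
      linarith
    have h7 : 72 * a ^ 2 * (2 ^ (j + 1) / s + ((j + 1 : ℕ) : ℝ) + 1) =
        4 * a * (2 ^ j / s + 1) * (18 * a) + 72 * a ^ 2 * (2 ^ j / s + j + 1) := by
      push_cast; ring
    rw [h7]
    linarith

/-- `2 ^ S` is the power of two just below `max 1 (n / L²)`, with `L = max 1 (log n)`. The upper
bound controls the halvings, the lower one the number of rows of the view, and `S` is at most `L /
log 2`. -/
theorem exists_width {n : ℝ} (hn : 0 < n) : ∃ S : ℕ,
    (2 : ℝ) ^ S ≤ 1 + n / max 1 (Real.log n) ^ 2 ∧ n ≤ 2 * max 1 (Real.log n) ^ 2 * 2 ^ S ∧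
      (S : ℝ) + 1 ≤ 3 * max 1 (Real.log n) := by
  set L := max 1 (Real.log n) with hL
  have hL1 : 1 ≤ L := le_max_left _ _
  have hL2 : 1 ≤ L ^ 2 := one_le_pow₀ hL1
  have hq : 0 ≤ n / L ^ 2 := by positivity
  obtain ⟨S, h1, h2⟩ := exists_nat_pow_near (le_max_left 1 (n / L ^ 2)) (one_lt_two (α := ℝ))
  refine ⟨S, h1.trans (max_le (by linarith) (by linarith)), ?_, ?_⟩
  · have h3 := (le_max_right 1 (n / L ^ 2)).trans h2.le
    rw [div_le_iff₀ (by positivity), pow_succ] at h3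
    linarith
  · rcases le_or_gt (n / L ^ 2) 1 with h | h
    · rw [max_eq_left h] at h1
      have : S = 0 := by
        by_contra h0
        have := one_lt_pow₀ (one_lt_two (α := ℝ)) h0
        linarith
      rw [this, Nat.cast_zero]
      linarith
    · rw [max_eq_right h.le] at h1
      have h3 : (2 : ℝ) ^ S ≤ n := h1.trans (div_le_self hn.le hL2)
      have h4 := Real.log_le_log (by positivity) h3
      rw [Real.log_pow] at h4
      have h5 := Real.log_two_gt_d9
      have h6 : Real.log n ≤ L := le_max_right _ _
      have h7 : (0 : ℝ) ≤ S := Nat.cast_nonneg S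
      nlinarith

/-- The number of columns of the view can be chosen such that a sketch takes few operations for all
sizes of the tensor unit. -/
theorem exists_sketchCost_le {d k : ℕ} (hd : 0 < d) (hk : 0 < k) : ∃ S : ℕ, ∀ s : ℕ, 0 < s → s ≤ k →
    (sketchCost s d k (k * (S + 1)) S : ℝ) ≤
      2720 * (d * k / s ^ 3 + k ^ 2 * max 1 (Real.log (d / k)) ^ 3 / s ^ 2) := by
  have hd' : (0 : ℝ) < d := by exact_mod_cast hd
  have hk' : (0 : ℝ) < k := by exact_mod_cast hk
  obtain ⟨S, h1, h2, h3⟩ := exists_width (div_pos hd' hk')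
  refine ⟨S, fun s hs hsk => ?_⟩
  have hs' : (0 : ℝ) < s := by exact_mod_cast hs
  have hs1 : (1 : ℝ) ≤ s := by exact_mod_cast hs
  set L := max 1 (Real.log ((d : ℝ) / k)) with hL
  have hL1 : 1 ≤ L := le_max_left _ _
  have hL0 : 0 < L := by linarith
  have hL3 : L ^ 2 ≤ L ^ 3 := pow_le_pow_right₀ hL1 (by norm_num)
  have hL3' : 1 ≤ L ^ 3 := one_le_pow₀ hL1
  have hsk' : (s : ℝ) ≤ k := by exact_mod_cast hsk
  set q : ℝ := 2 ^ S with hq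
  have hq0 : 0 < q := by positivity
  set X : ℝ := d * k / s ^ 3 with hX
  set Z : ℝ := k ^ 2 * L ^ 3 / s ^ 2 with hZ
  have hX0 : 0 ≤ X := by positivity
  have hZ0 : 0 ≤ Z := by positivity
  set T : ℝ := S + 1 with hT
  have hT0 : 0 < T := by positivity
  have hk1 : (k : ℝ) ≤ k ^ 2 * L ^ 3 := by
    have : (1 : ℝ) ≤ k := by linarith
    calc (k : ℝ) = k * 1 * 1 := by ring
      _ ≤ (k : ℝ) * k * L ^ 3 := by gcongr
      _ = _ := by ring
  have hkq : k * q ≤ k + d := by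
    have : (d : ℝ) / k / L ^ 2 ≤ d / k := div_le_self (by positivity) (one_le_pow₀ hL1)
    calc (k : ℝ) * q ≤ k * (1 + d / k) := by gcongr; linarith
      _ = (k : ℝ) + d := by field_simp
  have hdq : d / q ≤ 2 * L ^ 2 * k := by
    rw [div_le_iff₀ hq0]
    rw [div_le_iff₀ hk'] at h2
    linarith
  have e1 : k * q / s ^ 2 ≤ X + Z := by
    have : (d : ℝ) / s ^ 2 ≤ X := by
      rw [hX, div_le_div_iff₀ (by positivity) (by positivity)]
      calc (d : ℝ) * s ^ 3 = d * s ^ 2 * s := by ring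
        _ ≤ (d : ℝ) * s ^ 2 * k := by gcongr
        _ = _ := by ring
    have : (k : ℝ) / s ^ 2 ≤ Z := by rw [hZ]; gcongr
    calc (k : ℝ) * q / s ^ 2 ≤ ((k : ℝ) + d) / s ^ 2 := by gcongr
      _ = (k : ℝ) / s ^ 2 + d / s ^ 2 := by ring
      _ ≤ X + Z := by linarith
  have e2 : k * (d / q) / s ^ 2 ≤ 2 * Z := by
    calc (k : ℝ) * (d / q) / s ^ 2 ≤ k * (2 * L ^ 3 * k) / s ^ 2 := by
          gcongr
          exact hdq.trans (by gcongr)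
      _ = 2 * Z := by rw [hZ]; ring
  have e3 : (k : ℝ) / s ≤ Z := by
    rw [hZ, div_le_div_iff₀ (by positivity) (by positivity)]
    calc (k : ℝ) * s ^ 2 = k * s * 1 * s := by ring
      _ ≤ (k : ℝ) * k * L ^ 3 * s := by gcongr
      _ = _ := by ring
  have e4 : T ^ 2 * q ≤ 9 * (L ^ 3 + d / k) := by
    calc T ^ 2 * q ≤ (3 * L) ^ 2 * (1 + d / k / L ^ 2) := by gcongr
      _ = 9 * (L ^ 2 + (d : ℝ) / k) := by field_simp; ring
      _ ≤ _ := by gcongr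
  have e5 : k ^ 2 * (T ^ 2 * q) / s ^ 3 ≤ 9 * (Z + X) := by
    have : k ^ 2 * L ^ 3 / s ^ 3 ≤ Z := by
      rw [hZ]
      gcongr
      norm_num
    calc (k : ℝ) ^ 2 * (T ^ 2 * q) / s ^ 3 ≤ k ^ 2 * (9 * (L ^ 3 + d / k)) / s ^ 3 := by gcongr
      _ = 9 * ((k : ℝ) ^ 2 * L ^ 3 / s ^ 3 + X) := by rw [hX]; field_simp
      _ ≤ _ := by linarith
  have e6 : k ^ 2 * T ^ 3 / s ^ 2 ≤ 27 * Z := by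
    calc (k : ℝ) ^ 2 * T ^ 3 / s ^ 2 ≤ k ^ 2 * (3 * L) ^ 3 / s ^ 2 := by gcongr
      _ = 27 * Z := by rw [hZ]; ring
  have f1 := productCost_le hs hsk 1 (d / 2 ^ S + 1) (2 ^ S / s + 1)
  have f2 : ((2 ^ S / s + 1 : ℕ) : ℝ) ≤ q / s + 1 := by
    simpa using cast_div_succ_le (2 ^ S) s
  have f3 : ((d / 2 ^ S + 1 : ℕ) : ℝ) / s ≤ d / q / s + 1 := by
    have h4 : ((d / 2 ^ S + 1 : ℕ) : ℝ) ≤ d / q + 1 := by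
      simpa using cast_div_succ_le d (2 ^ S)
    calc ((d / 2 ^ S + 1 : ℕ) : ℝ) / s ≤ (d / q + 1) / s := by gcongr
      _ = (d : ℝ) / q / s + 1 / s := by ring
      _ ≤ _ := by
        gcongr
        rw [div_le_one hs']
        exact hs1
  have f4 : (productCost s k 1 (d / 2 ^ S + 1) (2 ^ S / s + 1) : ℝ) ≤
      4 * (k / s) * (q / s + 1) * (6 * (d / q / s) + 10) := by
    refine f1.trans ?_
    refine mul_le_mul (by gcongr) ?_ (by positivity) (by positivity)
    rw [Nat.cast_one]
    linarith
  -- The leading term is `d * k / s³`; the other three arise from rounding the columns, the rows, or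
  -- both up to whole blocks.
  have f5 : 4 * (k / s) * (q / s + 1) * (6 * (d / q / s) + 10) =
      24 * X + 40 * (k * q / s ^ 2) + 24 * (k * (d / q) / s ^ 2) + 40 * (k / s) := by
    rw [hX]; field_simp; ring
  have f6 := chainCost_le (r := k * (S + 1)) hs hsk (Nat.le_mul_of_pos_right k (by omega)) S k
    (Nat.le_mul_of_pos_right k (by omega))
  have f7 : 72 * (((k * (S + 1) : ℕ) : ℝ) / s) ^ 2 * (2 ^ S / s + S + 1) =
      72 * (k ^ 2 * (T ^ 2 * q) / s ^ 3) + 72 * (k ^ 2 * T ^ 3 / s ^ 2) := by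
    have : (((k * (S + 1) : ℕ) : ℝ)) = k * T := by push_cast; rw [hT]
    rw [this, ← hq, add_assoc, ← hT]
    field_simp
  -- Summing the estimates gives `712 * X + 2720 * Z`.
  rw [sketchCost, Nat.cast_add]
  linarith

end TCU

/-! ### The main theorem -/

theorem mainTheorem2 :
    ∃ (P : List TCU.Instr) (C K : ℝ), 0 < C ∧ 0 < K ∧
      ∀ (d k : ℕ) (ε δ : ℝ), 0 < d → 0 < ε → 0 < δ →
        C * ε⁻¹ ^ 2 * Real.log (1 / δ) ≤ k →
        ∃ (Ω : Type) (_ : MeasurableSpace Ω) (μ : MeasureTheory.Measure Ω)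
          (_ : MeasureTheory.IsProbabilityMeasure μ) (M : Ω → Matrix (Fin k) (Fin d) ℝ),
          IsJohnsonLindenstrauss μ M ε δ ∧
          ∀ (ω : Ω) (m s : ℕ) (τ : ℝ), m = s ^ 2 → 0 < s → s ≤ k → 1 ≤ τ →
            ∃ (u : List ℕ) (w : List ℝ), ∀ x : Fin d → ℝ, ∃ (t : ℝ) (σ : TCU.State),
              TCU.Runs s τ P (TCU.initial u w x) t σ ∧
              TCU.Output σ (M ω *ᵥ x) ∧
              t ≤ K * ((d * k + k ^ 2 * √(m : ℝ) * max 1 (Real.log (d / k)) ^ 3)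
                * τ * (m : ℝ) ^ (-(3 / 2) : ℝ)) ∧
              ∀ B : ℝ, τ ≤ B * m →
                t ≤ K * B * (d * k / √(m : ℝ) + k ^ 2 * max 1 (Real.log (d / k)) ^ 3) := by
  obtain ⟨C, hC, hJL⟩ := TCU.exists_johnsonLindenstrauss_sketch
  refine ⟨TCU.interpreter, C, 19 * 2721, hC, by norm_num, ?_⟩
  intro d k ε δ hd hε hδ hkC
  -- `S` is fixed before `s`, since one matrix has to serve all sizes of the tensor unit. For `k =
  -- 0` no `s` is admissible and any `S` will do.
  obtain ⟨S, hS⟩ : ∃ S : ℕ, ∀ s : ℕ, 0 < s → s ≤ k →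
      (TCU.sketchCost s d k (k * (S + 1)) S : ℝ) ≤
        2720 * (d * k / s ^ 3 + k ^ 2 * max 1 (Real.log (d / k)) ^ 3 / s ^ 2) := by
    rcases Nat.eq_zero_or_pos k with hk | hk
    · exact ⟨0, fun s h1 h2 => by omega⟩
    · exact TCU.exists_sketchCost_le hd hk
  obtain ⟨Ω, _, _, A₀, Af, A, hΩ⟩ := hJL d k S ε δ hε hδ hkC
  let _ : MeasurableSpace Ω := ⊤
  refine ⟨Ω, ⊤, ProbabilityTheory.uniformOn Set.univ,
    ProbabilityTheory.isProbabilityMeasure_uniformOn Set.finite_univ Set.univ_nonempty,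
    fun ω => TCU.sketchMatrix d k (k * (S + 1)) S (A₀ ω) (Af ω) (A ω),
    TCU.isJohnsonLindenstrauss_sketchMatrix hΩ, ?_⟩
  intro ω m s τ hm hs hsk hτ
  obtain ⟨w, ops, out, hv, hlen, hrun⟩ :=
    TCU.exists_ops_sketch hs d k (k * (S + 1)) S (A₀ ω) (Af ω) (A ω)
  obtain ⟨u, hu⟩ := TCU.exists_runs_interpreter (d := d) hτ ops hv w out
  refine ⟨u, w, fun x => ?_⟩
  obtain ⟨t, σ, hr, hmem, hreg, ht⟩ := hu x
  refine ⟨t, σ, hr, fun i => ?_, ?_⟩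
  · rw [hmem, hreg, hrun u x i i.2, TCU.sketchMatrix_mulVec]
  have hs' : (0 : ℝ) < s := by exact_mod_cast hs
  have hsk' : (s : ℝ) ≤ k := by exact_mod_cast hsk
  have hτ0 : 0 < τ := by linarith
  have hms : (m : ℝ) = (s : ℝ) ^ 2 := by rw [hm]; push_cast; rfl
  have hsq : √(m : ℝ) = s := by rw [hms, Real.sqrt_sq hs'.le]
  have hpow : (m : ℝ) ^ (-(3 / 2) : ℝ) = ((s : ℝ) ^ 3)⁻¹ := by
    rw [hms, ← Real.rpow_natCast, ← Real.rpow_mul hs'.le, ← Real.rpow_natCast (s : ℝ) 3,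
      ← Real.rpow_neg hs'.le]
    norm_num
  set L := max 1 (Real.log ((d : ℝ) / k)) with hL
  have hL3 : 1 ≤ L ^ 3 := one_le_pow₀ (le_max_left _ _)
  set Q : ℝ := d * k / s ^ 3 + k ^ 2 * L ^ 3 / s ^ 2 with hQ
  -- Here `s ≤ k` enters: it lets the additional round in which the interpreter halts be absorbed,
  -- turning `2720` into `2721`.
  have hQ1 : 1 ≤ Q := by
    have h1 : 1 ≤ (k : ℝ) ^ 2 * L ^ 3 / s ^ 2 := by
      rw [le_div_iff₀ (by positivity)]
      calc 1 * (s : ℝ) ^ 2 = (s : ℝ) ^ 2 * 1 := by ring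
        _ ≤ (k : ℝ) ^ 2 * L ^ 3 := by gcongr
    have h2 : 0 ≤ (d : ℝ) * k / s ^ 3 := by positivity
    linarith
  have hlen' : (ops.length : ℝ) ≤ 2720 * Q := (Nat.cast_le.2 hlen).trans (hS s hs hsk)
  have htQ : t ≤ 19 * 2721 * (Q * τ) := by
    calc t ≤ 19 * τ * (ops.length + 1) := ht
      _ ≤ 19 * τ * (2721 * Q) := by gcongr; linarith
      _ = _ := by ring
  constructor
  · refine htQ.trans (le_of_eq ?_)
    rw [hpow, hsq, hQ]
    field_simp
  · intro B hB
    refine htQ.trans ?_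
    calc 19 * 2721 * (Q * τ) ≤ 19 * 2721 * (Q * (B * m)) := by gcongr
      _ = _ := by rw [hsq, hms, hQ]; field_simp
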